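/- Notation. A convex body in $\mathbb{R}^n$ is a compact convex set with non-empty interior; it is $o$-symmetric if $-K=K$, in which case the origin $o$ lies in its interior. Let $|K|$ denote the volume (Lebesgue measure) of $K$, and let $\mathcal{H}^{n-1}$ denote the spherical Lebesgue measure on $S^{n-1}$, that is, the $(n-1)$-dimensional Hausdorff measure normalized so that it agrees with Lebesgue measure on $(n-1)$-dimensional subspaces. For a convex body $K$ with $o$ in its interior, let $h_K(u)=\max_{x\in K}\langle x,u\rangle$ be its support function and $\varrho_K(v)=\max\{t\ge 0: tv\in K\}$, $v\in S^{n-1}$, its radial function; for $x\in\partial K$ let $\nu_K(x)\subset S^{n-1}$ be the set of all exterior unit normals to $K$ at $x$, and for $\omega\subset S^{n-1}$ let $$\alpha_K^*(\omega)=\{v\in S^{n-1}:\ \nu_K(\varrho_K(v)v)\cap\omega\neq\emptyset\}.$$ For $q>0$ and $p\in\mathbb{R}$, the $q$th dual curvature measure $\widetilde{C}_{q,K}$ and the $L_p$ $q$th dual curvature measure $\widetilde{C}_{p,q,K}$ are the Borel measures on $S^{n-1}$ given by $$\widetilde{C}_{q,K}(\omega)=\int_{\alpha_K^*(\omega)}\varrho_K^{\,q}\,d\mathcal{H}^{n-1},\qquad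 d\widetilde{C}_{p,q,K}=h_K^{-p}\,d\widetilde{C}_{q,K}.$$ Theorem. Let $n$ be a natural number and let $\lambda>1$, $q>0$ and $p$ be real numbers with $-1<p<q<\min\{n,n+p\}$. There exists a constant $C>1$, depending only on $n$, $\lambda$, $p$ and $q$, such that every $o$-symmetric convex body $K\subset\mathbb{R}^n$ with $$\lambda^{-1}\mathcal{H}^{n-1}\le \widetilde{C}_{p,q,K}\le \lambda\,\mathcal{H}^{n-1}$$ (as measures on $S^{n-1}$) satisfies $$\operatorname{diam}K\le C\qquad\text{and}\qquad |K|\ge \frac1C .$$ -/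

import Mathlib

open MeasureTheory Metric Set

noncomputable section

namespace DualMinkowski

/-- Euclidean `n`-space. -/
abbrev Euc (n : ℕ) : Type := EuclideanSpace ℝ (Fin n)

/-- The unit sphere `S^{n-1}`. -/
abbrev Sph (n : ℕ) : Type := sphere (0 : Euc n) 1

/-- The spherical Lebesgue measure on `S^{n-1}` (that is, `(n-1)`-dimensional Hausdorff measure in
the normalization of Euclidean surface area; its total mass is `n` times the volume of the unit
ball). -/
abbrev sphMeasure (n : ℕ) : Measure (Sph n) := (volume : Measure (Euc n)).toSphere

variable {n : ℕ}

/-- The support function `h_K(u) = max_{x ∈ K} ⟨x, u⟩`. -/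
def supportFn (K : ConvexBody (Euc n)) (u : Euc n) : ℝ :=
  sSup ((fun x : Euc n => inner ℝ x u) '' (K : Set (Euc n)))

/-- The radial function `ϱ_K(v) = max {t ≥ 0 : t v ∈ K}`. -/
def radialFn (K : ConvexBody (Euc n)) (v : Euc n) : ℝ :=
  sSup {t : ℝ | 0 ≤ t ∧ t • v ∈ K}

/-- `ν_K(x)`: the set of all exterior unit normals to `K` at the point `x` of `K`. -/
def normals (K : ConvexBody (Euc n)) (x : Euc n) : Set (Sph n) :=
  {u | ∀ y ∈ K, inner ℝ y (u : Euc n) ≤ inner ℝ x (u : Euc n)}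

/-- The reverse radial Gauss image
`α*_K(ω) = {v ∈ S^{n-1} : ν_K(ϱ_K(v) v) ∩ ω ≠ ∅}`. -/
def reverseRadialGauss (K : ConvexBody (Euc n)) (ω : Set (Sph n)) : Set (Sph n) :=
  {v | (normals K (radialFn K v • (v : Euc n)) ∩ ω).Nonempty}

/-! ### The set function `ω ↦ ∫_{α*_K(ω)} ϱ_K^q` is countably additive

For a convex body with the origin in its interior, almost every boundary point in the radial sense
has exactly one exterior unit normal. -/

section aux

variable (K : ConvexBody (Euc n))

theorem radialFn_eq (h0 : (0 : Euc n) ∈ interior (K : Set (Euc n))) {v : Euc n} (hv : v ≠ 0) :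
    0 < gauge (K : Set (Euc n)) v ∧ radialFn K v = (gauge (K : Set (Euc n)) v)⁻¹ := by
  have hn : (K : Set (Euc n)) ∈ nhds (0 : Euc n) := mem_interior_iff_mem_nhds.1 h0
  have hg : 0 < gauge (K : Set (Euc n)) v :=
    (gauge_pos (absorbent_nhds_zero hn)
      (NormedSpace.isVonNBounded_of_isBounded ℝ K.isCompact.isBounded)).2 hv
  refine ⟨hg, ?_⟩
  have hset : {t : ℝ | 0 ≤ t ∧ t • v ∈ K} = Icc 0 (gauge (K : Set (Euc n)) v)⁻¹ := by
    ext t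
    simp only [mem_ofPred_eq, mem_Icc]
    refine and_congr_right fun ht => ?_
    have h1 : t • v ∈ K ↔ gauge (K : Set (Euc n)) (t • v) ≤ 1 := by
      rw [gauge_le_one_iff_mem_closure K.convex hn, K.isClosed.closure_eq]; rfl
    rw [h1, gauge_smul_of_nonneg ht, smul_eq_mul, ← one_div, le_div_iff₀ hg]
  rw [radialFn, hset, csSup_Icc (inv_nonneg.2 hg.le)]

theorem sph_ne_zero (v : Sph n) : (v : Euc n) ≠ 0 := ne_zero_of_mem_unit_sphere v

theorem normals_nonempty (h0 : (0 : Euc n) ∈ interior (K : Set (Euc n))) (v : Sph n) :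
    (normals K (radialFn K v • (v : Euc n))).Nonempty := by
  have hn : (K : Set (Euc n)) ∈ nhds (0 : Euc n) := mem_interior_iff_mem_nhds.1 h0
  obtain ⟨hg, hr⟩ := radialFn_eq K h0 (sph_ne_zero v)
  set x : Euc n := radialFn K v • (v : Euc n) with hx
  have hgx : gauge (K : Set (Euc n)) x = 1 := by
    rw [hx, gauge_smul_of_nonneg (by rw [hr]; positivity), hr, smul_eq_mul,
      inv_mul_cancel₀ hg.ne']
  have hxi : x ∉ interior (K : Set (Euc n)) := by
    rw [← gauge_lt_one_iff_mem_interior K.convex hn, hgx]; exact lt_irrefl _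
  obtain ⟨f, hf⟩ := geometric_hahn_banach_open_point K.convex.interior isOpen_interior hxi
  have hle : ∀ y ∈ K, f y ≤ f x := by
    intro y hy
    have hy' : y ∈ closure (interior (K : Set (Euc n))) := by
      rw [K.convex.closure_interior_eq_closure_of_nonempty_interior ⟨0, h0⟩]
      exact subset_closure hy
    exact closure_minimal (fun z hz => (hf z hz).le)
      (isClosed_le f.continuous continuous_const) hy'
  set w : Euc n := (InnerProductSpace.toDual ℝ (Euc n)).symm f with hw
  have hfw : ∀ y, f y = inner ℝ y w := by
    intro y
    rw [real_inner_comm, hw, InnerProductSpace.toDual_symm_apply]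
  have hw0 : w ≠ 0 := by
    intro h
    have := hf 0 h0
    rw [hfw, hfw, h] at this
    simp at this
  refine ⟨⟨‖w‖⁻¹ • w, by simp [norm_smul, hw0]⟩, fun y hy => ?_⟩
  have := hle y hy
  rw [hfw, hfw] at this
  simp only [inner_smul_right]
  exact mul_le_mul_of_nonneg_left this (by positivity)

theorem normals_subsingleton (h0 : (0 : Euc n) ∈ interior (K : Set (Euc n))) (v : Sph n)
    (hd : DifferentiableAt ℝ (gauge (K : Set (Euc n))) (v : Euc n)) :
    (normals K (radialFn K v • (v : Euc n))).Subsingleton := by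
  have hn : (K : Set (Euc n)) ∈ nhds (0 : Euc n) := mem_interior_iff_mem_nhds.1 h0
  obtain ⟨hg, hr⟩ := radialFn_eq K h0 (sph_ne_zero v)
  have key : ∀ u ∈ normals K (radialFn K v • (v : Euc n)), ∃ c : ℝ, 0 < c ∧
      c • fderiv ℝ (gauge (K : Set (Euc n))) (v : Euc n) = innerSL ℝ (u : Euc n) := by
    intro u hu
    have hu1 : ‖(u : Euc n)‖ = 1 := by simp
    set c : ℝ := inner ℝ (radialFn K v • (v : Euc n)) (u : Euc n) with hc
    have hcle : ∀ y ∈ K, inner ℝ y (u : Euc n) ≤ c := hu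
    have hcpos : 0 < c := by
      obtain ⟨r, hr0, hrK⟩ := Metric.mem_nhds_iff.1 hn
      have hmem : (r / 2) • (u : Euc n) ∈ K := hrK (by
        rw [mem_ball_zero_iff, norm_smul, hu1, Real.norm_eq_abs, abs_of_pos (by positivity)]
        linarith)
      have := hcle _ hmem
      rw [inner_smul_left, real_inner_self_eq_norm_sq, hu1] at this
      simp at this
      linarith
    have hbound : ∀ x : Euc n, inner ℝ x (u : Euc n) ≤ c * gauge (K : Set (Euc n)) x := by
      intro x
      by_cases hx : x = 0
      · simp [hx]
      obtain ⟨hgx, -⟩ := radialFn_eq K h0 hx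
      have hm : (gauge (K : Set (Euc n)) x)⁻¹ • x ∈ K := by
        have : (gauge (K : Set (Euc n)) x)⁻¹ • x ∈ closure (K : Set (Euc n)) := by
          rw [← gauge_le_one_iff_mem_closure K.convex hn,
            gauge_smul_of_nonneg (by positivity), smul_eq_mul, inv_mul_cancel₀ hgx.ne']
        rwa [K.isClosed.closure_eq] at this
      have := hcle _ hm
      rw [inner_smul_left] at this
      simp only [conj_trivial] at this
      rwa [inv_mul_le_iff₀ hgx, mul_comm] at this
    have heq : c * gauge (K : Set (Euc n)) (v : Euc n) = inner ℝ (v : Euc n) (u : Euc n) := by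
      rw [hc, hr, inner_smul_left]
      simp only [conj_trivial]
      field_simp
    refine ⟨c, hcpos, ?_⟩
    have hmin : IsLocalMin (fun x : Euc n => c * gauge (K : Set (Euc n)) x
        - innerSL ℝ (u : Euc n) x) (v : Euc n) := by
      refine Filter.Eventually.of_forall fun x => ?_
      have := hbound x
      simp only [innerSL_apply_apply]
      rw [real_inner_comm, heq, real_inner_comm x]
      linarith
    have hder := hmin.fderiv_eq_zero
    have hder2 := ((hd.hasFDerivAt.const_mul c).sub
      (innerSL ℝ (u : Euc n)).hasFDerivAt).fderiv
    have : c • fderiv ℝ (gauge (K : Set (Euc n))) (v : Euc n) - innerSL ℝ (u : Euc n) = 0 :=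
      hder2.symm.trans hder
    exact sub_eq_zero.1 this
  intro u hu u' hu'
  obtain ⟨c, hc, h⟩ := key u hu
  obtain ⟨c', hc', h'⟩ := key u' hu'
  have hn1 := congrArg norm h
  have hn2 := congrArg norm h'
  rw [norm_smul, innerSL_apply_norm, Real.norm_eq_abs, abs_of_pos hc] at hn1
  rw [norm_smul, innerSL_apply_norm, Real.norm_eq_abs, abs_of_pos hc'] at hn2
  have hu1 : ‖(u : Euc n)‖ = 1 := by simp
  have hu1' : ‖(u' : Euc n)‖ = 1 := by simp
  rw [hu1] at hn1
  rw [hu1'] at hn2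
  have hcc : c = c' := by
    have h3 : ‖fderiv ℝ (gauge (K : Set (Euc n))) (v : Euc n)‖ ≠ 0 := by
      intro h4
      rw [h4] at hn1
      simp at hn1
    exact mul_right_cancel₀ h3 (hn1.trans hn2.symm)
  rw [hcc, h'] at h
  exact Subtype.ext ((innerSL_inj (𝕜 := ℝ)).1 h).symm

theorem ae_differentiableAt_gauge (h0 : (0 : Euc n) ∈ interior (K : Set (Euc n))) :
    ∀ᵐ v : Sph n ∂(sphMeasure n), DifferentiableAt ℝ (gauge (K : Set (Euc n))) (v : Euc n) := by
  have hn : (K : Set (Euc n)) ∈ nhds (0 : Euc n) := mem_interior_iff_mem_nhds.1 h0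
  obtain ⟨C, hC⟩ := K.convex.lipschitz_gauge hn
  have hae := hC.ae_differentiableAt (μ := (volume : Measure (Euc n)))
  have hms : MeasurableSet {x : Euc n | DifferentiableAt ℝ (gauge (K : Set (Euc n))) x} :=
    measurableSet_of_differentiableAt ℝ _
  rw [ae_iff] at hae ⊢
  have hms' : MeasurableSet {v : Sph n |
      ¬ DifferentiableAt ℝ (gauge (K : Set (Euc n))) (v : Euc n)} :=
    measurable_subtype_coe hms.compl
  rw [Measure.toSphere_apply' _ hms']
  refine mul_eq_zero.2 (Or.inr (measure_mono_null ?_ hae))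
  rintro _ ⟨t, ht, _, ⟨v, hv, rfl⟩, rfl⟩
  intro hd
  apply hv
  have ht0 : 0 < t := ht.1
  have hfun : gauge (K : Set (Euc n)) = fun x => t⁻¹ * gauge (K : Set (Euc n)) (t • x) := by
    funext x
    rw [gauge_smul_of_nonneg ht0.le, smul_eq_mul, inv_mul_cancel_left₀ ht0.ne']
  rw [hfun]
  have hcomp : DifferentiableAt ℝ (gauge (K : Set (Euc n)) ∘ fun x : Euc n => t • x) (v : Euc n) :=
    DifferentiableAt.comp (v : Euc n) hd (differentiableAt_id.const_smul t)
  exact hcomp.const_mul t⁻¹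

theorem ae_normals_subsingleton (h0 : (0 : Euc n) ∈ interior (K : Set (Euc n))) :
    ∀ᵐ v : Sph n ∂(sphMeasure n), (normals K (radialFn K v • (v : Euc n))).Subsingleton :=
  (ae_differentiableAt_gauge K h0).mono fun v hv => normals_subsingleton K h0 v hv

theorem isClosed_reverseRadialGauss (h0 : (0 : Euc n) ∈ interior (K : Set (Euc n)))
    {F : Set (Sph n)} (hF : IsClosed F) : IsClosed (reverseRadialGauss K F) := by
  have hn : (K : Set (Euc n)) ∈ nhds (0 : Euc n) := mem_interior_iff_mem_nhds.1 h0
  have hcont : Continuous fun v : Sph n => radialFn K v := by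
    have : (fun v : Sph n => radialFn K v) = fun v : Sph n => (gauge (K : Set (Euc n)) v)⁻¹ :=
      funext fun v => (radialFn_eq K h0 (sph_ne_zero v)).2
    rw [this]
    exact ((continuous_gauge K.convex hn).comp continuous_subtype_val).inv₀
      fun v => (radialFn_eq K h0 (sph_ne_zero v)).1.ne'
  have hset : reverseRadialGauss K F = Prod.fst '' ({z : Sph n × Sph n | z.2 ∈ F} ∩
      ⋂ y ∈ K, {z : Sph n × Sph n | inner ℝ y (z.2 : Euc n)
        ≤ inner ℝ (radialFn K z.1 • (z.1 : Euc n)) (z.2 : Euc n)}) := by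
    ext v
    constructor
    · rintro ⟨u, hu, huF⟩
      exact ⟨(v, u), ⟨huF, mem_iInter₂.2 fun y hy => hu y hy⟩, rfl⟩
    · rintro ⟨⟨v', u⟩, ⟨huF, hu⟩, rfl⟩
      exact ⟨u, fun y hy => mem_iInter₂.1 hu y hy, huF⟩
  rw [hset]
  refine isClosedMap_fst_of_compactSpace _ ((hF.preimage continuous_snd).inter
    (isClosed_biInter fun y _ => isClosed_le ?_ ?_))
  · exact continuous_const.inner (continuous_subtype_val.comp continuous_snd)
  · exact ((hcont.comp continuous_fst).smul (continuous_subtype_val.comp continuous_fst)).inner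
      (continuous_subtype_val.comp continuous_snd)

theorem reverseRadialGauss_iUnion (ω : ℕ → Set (Sph n)) :
    reverseRadialGauss K (⋃ i, ω i) = ⋃ i, reverseRadialGauss K (ω i) := by
  ext v
  simp [reverseRadialGauss, inter_iUnion, nonempty_iUnion]

theorem reverseRadialGauss_empty : reverseRadialGauss K (∅ : Set (Sph n)) = ∅ := by
  ext v
  simp [reverseRadialGauss]

theorem aedisjoint_reverseRadialGauss (h0 : (0 : Euc n) ∈ interior (K : Set (Euc n)))
    {ω η : Set (Sph n)} (h : Disjoint ω η) :
    AEDisjoint (sphMeasure n) (reverseRadialGauss K ω) (reverseRadialGauss K η) := by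
  refine measure_mono_null ?_ (ae_iff.1 (ae_normals_subsingleton K h0))
  rintro v ⟨⟨u, hu, huω⟩, ⟨w, hw, hwη⟩⟩ hs
  have huw : u = w := hs hu hw
  subst huw
  exact disjoint_left.1 h huω hwη

theorem nullMeasurableSet_reverseRadialGauss (h0 : (0 : Euc n) ∈ interior (K : Set (Euc n)))
    {ω : Set (Sph n)} (hω : MeasurableSet ω) :
    NullMeasurableSet (reverseRadialGauss K ω) (sphMeasure n) := by
  have hcompl : ∀ η : Set (Sph n), NullMeasurableSet (reverseRadialGauss K η) (sphMeasure n) →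
      NullMeasurableSet (reverseRadialGauss K ηᶜ) (sphMeasure n) := by
    intro η hη
    refine hη.compl.congr ?_
    filter_upwards [ae_normals_subsingleton K h0] with v hv
    refine propext ⟨fun hvn => ?_, fun hvn hve => ?_⟩
    · obtain ⟨u, hu⟩ := normals_nonempty K h0 v
      exact ⟨u, hu, fun huη => hvn ⟨u, hu, huη⟩⟩
    · obtain ⟨u, hu, huη⟩ := hvn
      obtain ⟨w, hw, hwη⟩ := hve
      have huw : u = w := hv hu hw
      subst huw
      exact huη hwη
  induction ω, hω using MeasurableSet.induction_on_open with
  | isOpen U hU =>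
    have := hcompl Uᶜ
      (isClosed_reverseRadialGauss K h0 hU.isClosed_compl).measurableSet.nullMeasurableSet
    rwa [compl_compl] at this
  | compl t _ ih => exact hcompl t ih
  | iUnion f _ _ ih =>
    rw [reverseRadialGauss_iUnion]
    exact NullMeasurableSet.iUnion ih

end aux

/-- The `q`th dual curvature measure of a convex body with the origin in its interior:
the Borel measure on `S^{n-1}` with `C̃_{q,K}(ω) = ∫_{α*_K(ω)} ϱ_K(v)^q dH^{n-1}(v)`
for every Borel set `ω`. -/
def dualCurvature (q : ℝ) (K : ConvexBody (Euc n))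
    (h0 : (0 : Euc n) ∈ interior (K : Set (Euc n))) : Measure (Sph n) :=
  Measure.ofMeasurable
    (fun ω _ => ∫⁻ v in reverseRadialGauss K ω, ENNReal.ofReal (radialFn K v ^ q) ∂(sphMeasure n))
    (by simp [reverseRadialGauss_empty])
    (by
      intro f hf hd
      rw [reverseRadialGauss_iUnion]
      exact lintegral_iUnion₀ (fun i => nullMeasurableSet_reverseRadialGauss K h0 (hf i))
        (fun i j hij => aedisjoint_reverseRadialGauss K h0 (hd hij)) _)

theorem dualCurvature_apply (q : ℝ) (K : ConvexBody (Euc n))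
    (h0 : (0 : Euc n) ∈ interior (K : Set (Euc n))) {ω : Set (Sph n)} (hω : MeasurableSet ω) :
    dualCurvature q K h0 ω =
      ∫⁻ v in reverseRadialGauss K ω, ENNReal.ofReal (radialFn K v ^ q) ∂(sphMeasure n) :=
  Measure.ofMeasurable_apply ω hω

/-- The `L_p` `q`th dual curvature measure `dC̃_{p,q,K} = h_K^{-p} dC̃_{q,K}`. -/
def lpDualCurvature (p q : ℝ) (K : ConvexBody (Euc n))
    (h0 : (0 : Euc n) ∈ interior (K : Set (Euc n))) : Measure (Sph n) :=
  (dualCurvature q K h0).withDensity fun u => ENNReal.ofReal (supportFn K u ^ (-p))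

/-- An `o`-symmetric convex body with non-empty interior has the origin in its interior. -/
theorem zero_mem_interior_of_symmetric (K : ConvexBody (Euc n))
    (hint : (interior (K : Set (Euc n))).Nonempty) (hsymm : ∀ x ∈ K, -x ∈ K) :
    (0 : Euc n) ∈ interior (K : Set (Euc n)) := by
  obtain ⟨x, hx⟩ := hint
  have hx' : -x ∈ K := hsymm x (interior_subset hx)
  have := K.convex.combo_interior_self_mem_interior hx hx' (a := 1 / 2) (b := 1 / 2)
    (by norm_num) (by norm_num) (by norm_num)
  simpa using this

end DualMinkowski

end

noncomputable section

namespace DualMinkowski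

variable {n : ℕ}

/-! Write `h` for the support function, `ρ` for the radial function and `J = ∫ ρ^n = n|K|`. Let `R`
be the largest norm on `K`, attained in direction `e`, and `a` the minimum of `h`, attained at `w`.
By symmetry `h(u) ≥ R|⟨e,u⟩|`, and `K` lies in the slab `|⟨x,w⟩| ≤ a`. Fix `s` with `-1 < s <
min(0,p)`.

Since `h ≤ ρ ≤ R` along matching normals and directions, `ρ^n = ρ^(n-q) ρ^q` compares `J` with the
dual curvature measure, and the hypothesis compares the latter with `∫ h^p`. On the cap `⟨e,u⟩ ≥
1/2` the support function is of order `R`, so `J ≥ c₁ R^(n+p-q)` (`le_lintegral_radialFn_of_cap`).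
Conversely, where `h ≤ t`, one has `h^p ≤ t^(p-s) (R|⟨e,u⟩|)^s`, and the singular factor is
integrable because `s > -1`. With `t = R` this gives `J ≤ c₂ R^(n+p-q)`
(`setLIntegral_radialFn_le_of_supportFn_le`).

The key point excludes thin bodies. Integrating by parts in direction `w` against the tent function
`1 - g`, with `g` the gauge, gives `J ≤ n a ∫ ρ^n |∂_w g|`, and `|∂_w g| ≤ 1/h` at the normal. Hence
normals with `h < 2na` carry at least the proportion `1/(2n)` of `J`
(`lintegral_radialFn_pow_le_of_slab`). Taking `t = 2na` above yields `J ≤ c₃ R^(n-q+s) a^(p-s)`.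
Against the lower bound for `J` this bounds `R/a`, since `p > s`.

Finally `a^n S ≤ J ≤ R^n S`, with `S` the area of the sphere. As `p < q`, the exponents `n` and
`n+p-q` differ, so `R` is bounded above and below, and then `J` is bounded below
(`exists_scale_bounds`). -/

/-! ### Polar coordinates -/

theorem finrank_euc : Module.finrank ℝ (Euc n) = n := by simp

/-- Integration in polar coordinates on Euclidean space. -/
theorem lintegral_polar (hn : n ≠ 0) {f : Euc n → ENNReal} (hf : Measurable f) :
    ∫⁻ x, f x = ∫⁻ v : Sph n, (∫⁻ r in Ioi (0 : ℝ),
      ENNReal.ofReal (r ^ (n - 1)) * f (r • (v : Euc n))) ∂(sphMeasure n) := by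
  have : NeZero n := ⟨hn⟩
  have : Nontrivial (Euc n) := Module.nontrivial_of_finrank_pos (R := ℝ) (by
    rw [finrank_euc]; exact Nat.pos_of_ne_zero hn)
  have hmp := (volume : Measure (Euc n)).measurePreserving_homeomorphUnitSphereProd
  rw [finrank_euc] at hmp
  have h1 : ∫⁻ x, f x = ∫⁻ x : ({0}ᶜ : Set (Euc n)), f x ∂(volume.comap ((↑) : ({0}ᶜ : Set (Euc n)) → Euc n)) := by
    rw [lintegral_subtype_comap (measurableSet_singleton _).compl, restrict_compl_singleton]
  have h2 := hmp.symm (homeomorphUnitSphereProd (Euc n)).toMeasurableEquiv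
  have h3 := h2.lintegral_comp_emb (MeasurableEquiv.measurableEmbedding _)
    (fun x : ({0}ᶜ : Set (Euc n)) => f x)
  rw [h1, ← h3, lintegral_prod _ (by fun_prop)]
  refine lintegral_congr fun v => ?_
  rw [Measure.volumeIoiPow, lintegral_withDensity_eq_lintegral_mul _ (by fun_prop)
    (by fun_prop)]
  rw [← lintegral_subtype_comap measurableSet_Ioi]
  rfl

theorem lintegral_Ioc_rpow {s R : ℝ} (hs : 0 < s) (hR : 0 ≤ R) :
    ∫⁻ r in Ioc 0 R, ENNReal.ofReal (r ^ (s - 1)) = ENNReal.ofReal (R ^ s / s) := by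
  rw [← ofReal_integral_eq_lintegral_ofReal
    (intervalIntegral.intervalIntegrable_rpow' (by linarith)).1,
    ← intervalIntegral.integral_of_le hR, integral_rpow (Or.inl (by linarith))]
  · simp [Real.zero_rpow hs.ne']
  · filter_upwards [ae_restrict_mem measurableSet_Ioc] with r hr
    exact Real.rpow_nonneg hr.1.le _

/-- Polar coordinates for the integral of a positively homogeneous function over a set which is
star-shaped with radial function `ρ`. -/
theorem setLIntegral_homogeneous (hn : n ≠ 0) {s : Set (Euc n)} (hs : MeasurableSet s)
    {ρ : Sph n → ℝ} (hρ : ∀ v, 0 ≤ ρ v)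
    (hmem : ∀ (v : Sph n) (r : ℝ), 0 < r → (r • (v : Euc n) ∈ s ↔ r ≤ ρ v))
    {G : Euc n → ENNReal} (hG : Measurable G) {d : ℝ} (hd : 0 < n + d)
    (hhom : ∀ (v : Sph n) (r : ℝ), 0 < r → G (r • (v : Euc n)) = ENNReal.ofReal (r ^ d) * G v) :
    ∫⁻ x in s, G x =
      ∫⁻ v : Sph n, ENNReal.ofReal (ρ v ^ (n + d) / (n + d)) * G v ∂(sphMeasure n) := by
  rw [← lintegral_indicator hs, lintegral_polar hn (hG.indicator hs)]
  refine lintegral_congr fun v => ?_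
  rw [← lintegral_Ioc_rpow hd (hρ v), ← lintegral_mul_const _ (by fun_prop)]
  rw [← lintegral_indicator measurableSet_Ioc, ← lintegral_indicator measurableSet_Ioi]
  refine lintegral_congr fun r => ?_
  by_cases hr : 0 < r
  · have hpow : r ^ (n + d - 1) = r ^ (n - 1) * r ^ d := by
      rw [← Real.rpow_natCast, ← Real.rpow_add hr, Nat.cast_sub (Nat.one_le_iff_ne_zero.2 hn)]
      congr 1; push_cast; ring
    by_cases hm : r ≤ ρ v
    · rw [indicator_of_mem (mem_Ioi.2 hr), indicator_of_mem ((hmem v r hr).2 hm),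
        indicator_of_mem (mem_Ioc.2 ⟨hr, hm⟩), hhom v r hr, hpow,
        ENNReal.ofReal_mul (by positivity), mul_assoc]
    · rw [indicator_of_mem (mem_Ioi.2 hr), indicator_of_notMem (mt (hmem v r hr).1 hm),
        indicator_of_notMem (fun h => hm h.2), mul_zero]
  · rw [indicator_of_notMem (by simpa using hr), indicator_of_notMem (fun h => hr h.1)]

/-! ### Gauge, radial function and support function -/

section body

variable (K : ConvexBody (Euc n))

theorem mem_iff_gauge_le_one (h0 : (0 : Euc n) ∈ interior (K : Set (Euc n))) (x : Euc n) :
    x ∈ K ↔ gauge (K : Set (Euc n)) x ≤ 1 := by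
  rw [gauge_le_one_iff_mem_closure K.convex (mem_interior_iff_mem_nhds.1 h0),
    K.isClosed.closure_eq]
  rfl

theorem continuous_gauge_body (h0 : (0 : Euc n) ∈ interior (K : Set (Euc n))) :
    Continuous (gauge (K : Set (Euc n))) :=
  continuous_gauge K.convex (mem_interior_iff_mem_nhds.1 h0)

theorem radialFn_pos (h0 : (0 : Euc n) ∈ interior (K : Set (Euc n))) (v : Sph n) :
    0 < radialFn K v := by
  obtain ⟨hg, hr⟩ := radialFn_eq K h0 (sph_ne_zero v)
  rw [hr]; positivity

theorem continuous_radialFn (h0 : (0 : Euc n) ∈ interior (K : Set (Euc n))) :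
    Continuous fun v : Sph n => radialFn K v := by
  have : (fun v : Sph n => radialFn K v) = fun v : Sph n => (gauge (K : Set (Euc n)) v)⁻¹ :=
    funext fun v => (radialFn_eq K h0 (sph_ne_zero v)).2
  rw [this]
  exact ((continuous_gauge_body K h0).comp continuous_subtype_val).inv₀
    fun v => (radialFn_eq K h0 (sph_ne_zero v)).1.ne'

theorem smul_mem_iff_le_radialFn (h0 : (0 : Euc n) ∈ interior (K : Set (Euc n))) (v : Sph n)
    {r : ℝ} (hr : 0 < r) : r • (v : Euc n) ∈ K ↔ r ≤ radialFn K v := by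
  obtain ⟨hg, hρ⟩ := radialFn_eq K h0 (sph_ne_zero v)
  rw [mem_iff_gauge_le_one K h0, gauge_smul_of_nonneg hr.le, smul_eq_mul, hρ, ← one_div,
    le_div_iff₀ hg]

theorem radialFn_smul_mem (h0 : (0 : Euc n) ∈ interior (K : Set (Euc n))) (v : Sph n) :
    radialFn K v • (v : Euc n) ∈ K :=
  (smul_mem_iff_le_radialFn K h0 v (radialFn_pos K h0 v)).2 le_rfl

theorem isCompact_image_inner (u : Euc n) :
    IsCompact ((fun x : Euc n => inner ℝ x u) '' (K : Set (Euc n))) :=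
  K.isCompact.image (by fun_prop)

theorem inner_le_supportFn {x : Euc n} (hx : x ∈ K) (u : Euc n) : inner ℝ x u ≤ supportFn K u :=
  le_csSup (isCompact_image_inner K u).bddAbove ⟨x, hx, rfl⟩

theorem supportFn_le {u : Euc n} {c : ℝ} (h : ∀ x ∈ K, inner ℝ x u ≤ c) : supportFn K u ≤ c := by
  refine csSup_le (K.nonempty.image _) ?_
  rintro _ ⟨x, hx, rfl⟩
  exact h x hx

theorem continuous_supportFn : Continuous (supportFn K) :=
  K.isCompact.continuous_sSup (f := fun (u : Euc n) (x : Euc n) => inner ℝ x u)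
    (by fun_prop)

theorem supportFn_eq_of_mem_normals {x : Euc n} (hx : x ∈ K) {u : Sph n} (hu : u ∈ normals K x) :
    supportFn K u = inner ℝ x (u : Euc n) :=
  le_antisymm (supportFn_le K hu) (inner_le_supportFn K hx _)

theorem supportFn_pos (h0 : (0 : Euc n) ∈ interior (K : Set (Euc n))) (u : Sph n) :
    0 < supportFn K u := by
  refine lt_of_lt_of_le ?_ (inner_le_supportFn K (radialFn_smul_mem K h0 u) _)
  have hu1 : ‖(u : Euc n)‖ = 1 := by simp
  rw [real_inner_smul_left, real_inner_self_eq_norm_sq, hu1]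
  simpa using radialFn_pos K h0 u

theorem inner_le_supportFn_mul_gauge (h0 : (0 : Euc n) ∈ interior (K : Set (Euc n)))
    (x u : Euc n) : inner ℝ x u ≤ supportFn K u * gauge (K : Set (Euc n)) x := by
  by_cases hx : x = 0
  · simp [hx]
  obtain ⟨hgx, -⟩ := radialFn_eq K h0 hx
  have hm : (gauge (K : Set (Euc n)) x)⁻¹ • x ∈ K := by
    rw [mem_iff_gauge_le_one K h0, gauge_smul_of_nonneg (by positivity), smul_eq_mul,
      inv_mul_cancel₀ hgx.ne']
  have := inner_le_supportFn K hm u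
  rwa [real_inner_smul_left, inv_mul_le_iff₀ hgx, mul_comm] at this

/-- The function `h(u) g - ⟨·,u⟩` is nonnegative and vanishes at `v`, so its derivative there is
zero: the gradient of the gauge is the normal divided by the support function. -/
theorem supportFn_mul_lineDeriv_gauge (h0 : (0 : Euc n) ∈ interior (K : Set (Euc n))) (v : Sph n)
    (hd : DifferentiableAt ℝ (gauge (K : Set (Euc n))) (v : Euc n)) {u : Sph n}
    (hu : u ∈ normals K (radialFn K v • (v : Euc n))) (w : Euc n) :
    supportFn K u * lineDeriv ℝ (gauge (K : Set (Euc n))) v w = inner ℝ w (u : Euc n) := by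
  obtain ⟨hg, hr⟩ := radialFn_eq K h0 (sph_ne_zero v)
  set c := supportFn K u with hc
  have heq : c * gauge (K : Set (Euc n)) (v : Euc n) = inner ℝ (v : Euc n) (u : Euc n) := by
    rw [hc, supportFn_eq_of_mem_normals K (radialFn_smul_mem K h0 v) hu, hr,
      real_inner_smul_left]
    field_simp
  have hmin : IsLocalMin (fun x : Euc n => c * gauge (K : Set (Euc n)) x
      - innerSL ℝ (u : Euc n) x) (v : Euc n) := by
    refine Filter.Eventually.of_forall fun x => ?_
    have := inner_le_supportFn_mul_gauge K h0 x u
    simp only [innerSL_apply_apply]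
    rw [real_inner_comm, heq, real_inner_comm x]
    linarith
  have hder := hmin.fderiv_eq_zero
  have hder2 := ((hd.hasFDerivAt.const_mul c).sub (innerSL ℝ (u : Euc n)).hasFDerivAt).fderiv
  have h3 : c • fderiv ℝ (gauge (K : Set (Euc n))) (v : Euc n) - innerSL ℝ (u : Euc n) = 0 :=
    hder2.symm.trans hder
  have h4 := DFunLike.congr_fun (sub_eq_zero.1 h3) w
  rw [hd.lineDeriv_eq_fderiv, ← real_inner_comm]
  simpa using h4

theorem lineDeriv_gauge_smul (x w : Euc n) {r : ℝ} (hr : 0 < r) :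
    lineDeriv ℝ (gauge (K : Set (Euc n))) (r • x) w
      = lineDeriv ℝ (gauge (K : Set (Euc n))) x w := by
  have h : (fun t : ℝ => gauge (K : Set (Euc n)) (r • x + t • w)) =
      fun t : ℝ => r * (fun t : ℝ => gauge (K : Set (Euc n)) (x + t • w)) (r⁻¹ * t) := by
    funext t
    have : r • x + t • w = r • (x + (r⁻¹ * t) • w) := by
      rw [smul_add, smul_smul, mul_inv_cancel_left₀ hr.ne']
    simp only
    rw [this, gauge_smul_of_nonneg hr.le, smul_eq_mul]
  rw [lineDeriv, h, deriv_const_mul_field, deriv_comp_mul_left r⁻¹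
    (fun t : ℝ => gauge (K : Set (Euc n)) (x + t • w))]
  simp only [mul_zero, smul_eq_mul]
  rw [mul_inv_cancel_left₀ hr.ne', lineDeriv]

/-! ### Integrals over the body and integration by parts -/

theorem setLIntegral_body_homogeneous (h0 : (0 : Euc n) ∈ interior (K : Set (Euc n))) (hn : n ≠ 0)
    {G : Euc n → ENNReal} (hG : Measurable G) {d : ℝ} (hd : 0 < n + d)
    (hhom : ∀ (v : Sph n) (r : ℝ), 0 < r → G (r • (v : Euc n)) = ENNReal.ofReal (r ^ d) * G v) :
    ∫⁻ x in (K : Set (Euc n)), G x =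
      ∫⁻ v : Sph n, ENNReal.ofReal (radialFn K v ^ (n + d) / (n + d)) * G v ∂(sphMeasure n) :=
  setLIntegral_homogeneous hn K.isClosed.measurableSet (fun v => (radialFn_pos K h0 v).le)
    (fun v _ hr => smul_mem_iff_le_radialFn K h0 v hr) hG hd hhom

theorem volume_eq_lintegral_radialFn (h0 : (0 : Euc n) ∈ interior (K : Set (Euc n)))
    (hn : n ≠ 0) :
    n * volume (K : Set (Euc n)) =
      ∫⁻ v : Sph n, ENNReal.ofReal (radialFn K v ^ (n : ℝ)) ∂(sphMeasure n) := by
  have hn' : (0 : ℝ) < n := by positivity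
  have h := setLIntegral_body_homogeneous K h0 hn (G := fun _ => 1) measurable_const (d := 0)
    (by simpa using hn') (by simp)
  simp only [add_zero, mul_one, setLIntegral_const, one_mul] at h
  rw [h, ← ENNReal.ofReal_natCast, ← lintegral_const_mul' _ _ ENNReal.ofReal_ne_top]
  refine lintegral_congr fun v => ?_
  rw [← ENNReal.ofReal_mul hn'.le]
  congr 1
  field_simp

/-- Degree one homogeneity raises the radial power to `n + 1`, and `g(v) = 1/ρ(v)` lowers it back to
`n`. -/
theorem lintegral_gauge (h0 : (0 : Euc n) ∈ interior (K : Set (Euc n))) (hn : n ≠ 0) :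
    (n + 1) * ∫⁻ x in (K : Set (Euc n)), ENNReal.ofReal (gauge (K : Set (Euc n)) x) =
      ∫⁻ v : Sph n, ENNReal.ofReal (radialFn K v ^ (n : ℝ)) ∂(sphMeasure n) := by
  have hn1 : (0 : ℝ) < n + 1 := by positivity
  rw [setLIntegral_body_homogeneous K h0 hn
    (continuous_gauge_body K h0).measurable.ennreal_ofReal (d := 1) hn1 ?_]
  · rw [show (n + 1 : ENNReal) = ENNReal.ofReal (n + 1) by
      rw [ENNReal.ofReal_add (by positivity) zero_le_one]; simp,
      ← lintegral_const_mul' _ _ ENNReal.ofReal_ne_top]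
    refine lintegral_congr fun v => ?_
    have hρ := radialFn_pos K h0 v
    obtain ⟨hg, hr⟩ := radialFn_eq K h0 (sph_ne_zero v)
    have hg' : gauge (K : Set (Euc n)) v = (radialFn K v)⁻¹ := by rw [hr, inv_inv]
    rw [hg', ← ENNReal.ofReal_mul (by positivity), ← ENNReal.ofReal_mul (by positivity),
      Real.rpow_add_one hρ.ne']
    congr 1
    field_simp
  · intro v r hr
    rw [gauge_smul_of_nonneg hr.le, smul_eq_mul, ENNReal.ofReal_mul hr.le, Real.rpow_one]

/-- The derivative of the gauge is homogeneous of degree zero, so the extra factor `g` makes the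
integrand again of degree one. -/
theorem lintegral_gauge_mul_lineDeriv (h0 : (0 : Euc n) ∈ interior (K : Set (Euc n)))
    (hn : n ≠ 0) (w : Euc n) :
    (n + 1) * ∫⁻ x in (K : Set (Euc n)), ENNReal.ofReal
      (gauge (K : Set (Euc n)) x * |lineDeriv ℝ (gauge (K : Set (Euc n))) x w|) =
      ∫⁻ v : Sph n, ENNReal.ofReal (radialFn K v ^ (n : ℝ)
        * |lineDeriv ℝ (gauge (K : Set (Euc n))) v w|) ∂(sphMeasure n) := by
  have hn1 : (0 : ℝ) < n + 1 := by positivity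
  have hcont := continuous_gauge_body K h0
  have hmeas : Measurable fun x => ENNReal.ofReal
      (gauge (K : Set (Euc n)) x * |lineDeriv ℝ (gauge (K : Set (Euc n))) x w|) :=
    (hcont.measurable.mul
      (continuous_abs.measurable.comp (measurable_lineDeriv hcont))).ennreal_ofReal
  rw [setLIntegral_body_homogeneous K h0 hn hmeas (d := 1) hn1 ?_]
  · rw [show (n + 1 : ENNReal) = ENNReal.ofReal (n + 1) by
      rw [ENNReal.ofReal_add (by positivity) zero_le_one]; simp,
      ← lintegral_const_mul' _ _ ENNReal.ofReal_ne_top]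
    refine lintegral_congr fun v => ?_
    have hρ := radialFn_pos K h0 v
    obtain ⟨hg, hr⟩ := radialFn_eq K h0 (sph_ne_zero v)
    have hg' : gauge (K : Set (Euc n)) v = (radialFn K v)⁻¹ := by rw [hr, inv_inv]
    rw [← ENNReal.ofReal_mul (by positivity), ← ENNReal.ofReal_mul (by positivity),
      Real.rpow_add_one hρ.ne']
    congr 1
    rw [hg']
    field_simp
  · intro v r hr
    rw [lineDeriv_gauge_smul K v w hr, gauge_smul_of_nonneg hr.le, smul_eq_mul, mul_assoc, ENNReal.ofReal_mul hr.le,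
      Real.rpow_one]

/-- Integration by parts against the tent function `max (1 - g) 0`, where `g` is the gauge. -/
theorem setLIntegral_one_sub_gauge_le (h0 : (0 : Euc n) ∈ interior (K : Set (Euc n)))
    {w : Euc n} (hw : ‖w‖ = 1) {a : ℝ} (ha : ∀ x ∈ K, |inner ℝ x w| ≤ a) :
    ∫⁻ x in (K : Set (Euc n)), ENNReal.ofReal (1 - gauge (K : Set (Euc n)) x) ≤
      ENNReal.ofReal a * ∫⁻ x in (K : Set (Euc n)), ENNReal.ofReal
        (gauge (K : Set (Euc n)) x * |lineDeriv ℝ (gauge (K : Set (Euc n))) x w|) := by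
  set g := gauge (K : Set (Euc n)) with hg
  have ha0 : 0 ≤ a := by simpa using ha 0 (interior_subset h0)
  obtain ⟨C, hC⟩ := K.convex.lipschitz_gauge (mem_interior_iff_mem_nhds.1 h0)
  set φ : Euc n → ℝ := fun x => max (1 - g x) 0 with hφ
  have hφL : LipschitzWith (0 + C) φ := ((LipschitzWith.const 1).sub hC).max_const 0
  have hφK : ∀ x, x ∉ K → φ x = 0 := by
    intro x hx
    have : 1 < g x := not_le.1 (mt (mem_iff_gauge_le_one K h0 x).2 hx)
    exact max_eq_right (by linarith)
  have hφc : HasCompactSupport φ := HasCompactSupport.intro K.isCompact hφK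
  have hφi : Integrable φ := hφL.continuous.integrable_of_hasCompactSupport hφc
  have hfL : LipschitzWith ‖innerSL ℝ w‖₊ (innerSL ℝ w) := (innerSL ℝ w).lipschitz
  -- The other factor is `⟨w,·⟩`, whose derivative along the unit vector `w` is 1, so the left side
  -- is just `∫ φ`.
  have hparts := hfL.integral_lineDeriv_mul_eq (μ := volume) hφL hφc w
  have hfw : ∀ x, lineDeriv ℝ (innerSL ℝ w) x w = 1 := by
    intro x
    rw [(innerSL ℝ w).differentiableAt.lineDeriv_eq_fderiv, ContinuousLinearMap.fderiv]
    simp [hw]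
  simp only [hfw, one_mul] at hparts
  have hleft : ∫⁻ x in (K : Set (Euc n)), ENNReal.ofReal (1 - g x) = ENNReal.ofReal (∫ x, φ x) := by
    rw [ofReal_integral_eq_lintegral_ofReal hφi (ae_of_all _ fun x => le_max_right _ _),
      ← lintegral_indicator K.isClosed.measurableSet]
    refine lintegral_congr fun x => ?_
    by_cases hx : x ∈ K
    · have : g x ≤ 1 := (mem_iff_gauge_le_one K h0 x).1 hx
      rw [indicator_of_mem (by exact hx), hφ]
      simp only
      rw [max_eq_left (by linarith)]
    · rw [indicator_of_notMem (by exact hx), hφK x hx, ENNReal.ofReal_zero]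
  have hae : ∀ᵐ x : Euc n, ‖lineDeriv ℝ φ x (-w) * innerSL ℝ w x‖ₑ ≤
      (K : Set (Euc n)).indicator
        (fun x => ENNReal.ofReal a * ENNReal.ofReal (g x * |lineDeriv ℝ g x w|)) x := by
    -- The tent agrees locally with `1 - g` or with `0` off the boundary, which is null by
    -- convexity.
    have hfr : ∀ᵐ x : Euc n, x ∉ frontier (K : Set (Euc n)) :=
      measure_eq_zero_iff_ae_notMem.1 (K.convex.addHaar_frontier volume)
    filter_upwards [hfr] with x hx
    by_cases hxK : x ∈ K
    · have hxi : x ∈ interior (K : Set (Euc n)) := by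
        by_contra h
        exact hx ⟨subset_closure hxK, h⟩
      rw [indicator_of_mem (by exact hxK), ← ENNReal.ofReal_mul ha0, ← ofReal_norm]
      refine ENNReal.ofReal_le_ofReal ?_
      have hev : φ =ᶠ[nhds x] fun y => 1 - g y := by
        filter_upwards [isOpen_interior.mem_nhds hxi] with y hy
        have : g y ≤ 1 := (mem_iff_gauge_le_one K h0 y).1 (interior_subset hy)
        exact max_eq_left (by linarith)
      -- The sign from `1 - g` cancels the sign from `-w`.
      have hder : lineDeriv ℝ φ x (-w) = lineDeriv ℝ g x w := by
        rw [hev.lineDeriv_eq, lineDeriv_neg, lineDeriv]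
        rw [deriv_const_sub, neg_neg, lineDeriv]
      -- Scaling `x` to the boundary improves the slab bound by `g x`; this supplies the factor of
      -- degree one used in polar coordinates.
      have hin : |inner ℝ x w| ≤ a * g x := by
        by_cases hx0 : g x = 0
        · have : x = 0 := by
            by_contra h
            exact (radialFn_eq K h0 h).1.ne' hx0
          simp [this, hg]
        · have hgx : 0 < g x := lt_of_le_of_ne (gauge_nonneg _) (Ne.symm hx0)
          have hm : (g x)⁻¹ • x ∈ K := by
            rw [mem_iff_gauge_le_one K h0, gauge_smul_of_nonneg (by positivity), smul_eq_mul,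
              inv_mul_cancel₀ hx0]
          have := ha _ hm
          rw [real_inner_smul_left, abs_mul, abs_of_pos (by positivity),
            inv_mul_le_iff₀ hgx] at this
          linarith
      rw [hder, norm_mul, innerSL_apply_apply, real_inner_comm, Real.norm_eq_abs,
        Real.norm_eq_abs]
      calc _ ≤ |lineDeriv ℝ g x w| * (a * g x) := by gcongr
        _ = _ := by ring
    · have hev : φ =ᶠ[nhds x] fun _ => 0 := by
        filter_upwards [K.isClosed.isOpen_compl.mem_nhds hxK] with y hy
        exact hφK y hy
      rw [hev.lineDeriv_eq]
      simp [lineDeriv]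
  have hg0 : ∀ x, 0 ≤ g x := fun x => gauge_nonneg x
  rw [hleft, hparts]
  calc ENNReal.ofReal (∫ x, lineDeriv ℝ φ x (-w) * innerSL ℝ w x)
      ≤ ‖∫ x, lineDeriv ℝ φ x (-w) * innerSL ℝ w x‖ₑ := Real.ofReal_le_enorm _
    _ ≤ ∫⁻ x, ‖lineDeriv ℝ φ x (-w) * innerSL ℝ w x‖ₑ := enorm_integral_le_lintegral_enorm _
    _ ≤ _ := lintegral_mono_ae hae
    _ = _ := by
      rw [lintegral_indicator K.isClosed.measurableSet,
        lintegral_const_mul' _ _ ENNReal.ofReal_ne_top]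

/-- In polar coordinates `∫_K (1 - g) = J/n - J/(n+1) = J/(n(n+1))`, which is compared with
`a/(n+1)` times the weighted derivative integral. -/
theorem lintegral_radialFn_pow_le (h0 : (0 : Euc n) ∈ interior (K : Set (Euc n))) (hn : n ≠ 0)
    {w : Euc n} (hw : ‖w‖ = 1) {a : ℝ} (ha : ∀ x ∈ K, |inner ℝ x w| ≤ a) :
    ∫⁻ v : Sph n, ENNReal.ofReal (radialFn K v ^ (n : ℝ)) ∂(sphMeasure n) ≤
      n * (ENNReal.ofReal a * ∫⁻ v : Sph n, ENNReal.ofReal (radialFn K v ^ (n : ℝ)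
        * |lineDeriv ℝ (gauge (K : Set (Euc n))) v w|) ∂(sphMeasure n)) := by
  have h1 := setLIntegral_one_sub_gauge_le K h0 hw ha
  have h2 := lintegral_gauge K h0 hn
  have h3 := volume_eq_lintegral_radialFn K h0 hn
  have h4 := lintegral_gauge_mul_lineDeriv K h0 hn w
  have h5 : volume (K : Set (Euc n)) ≤
      (∫⁻ x in (K : Set (Euc n)), ENNReal.ofReal (1 - gauge (K : Set (Euc n)) x)) +
      ∫⁻ x in (K : Set (Euc n)), ENNReal.ofReal (gauge (K : Set (Euc n)) x) := by
    rw [← lintegral_add_right _ (continuous_gauge_body K h0).measurable.ennreal_ofReal,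
      ← setLIntegral_one]
    refine lintegral_mono fun x => ?_
    rw [← ENNReal.ofReal_one]
    refine le_trans (ENNReal.ofReal_le_ofReal (by simp)) ENNReal.ofReal_add_le
  set J := ∫⁻ v : Sph n, ENNReal.ofReal (radialFn K v ^ (n : ℝ)) ∂(sphMeasure n) with hJ
  rw [← h4]
  set I := ∫⁻ x in (K : Set (Euc n)), ENNReal.ofReal (gauge (K : Set (Euc n)) x) with hI
  set P := ∫⁻ x in (K : Set (Euc n)), ENNReal.ofReal
      (gauge (K : Set (Euc n)) x * |lineDeriv ℝ (gauge (K : Set (Euc n))) x w|) with hP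
  -- Finiteness is what permits cancelling `n * J` in `ENNReal`.
  have hJtop : J ≠ ⊤ := by
    rw [← h3]; exact ENNReal.mul_ne_top (by simp) K.isCompact.measure_lt_top.ne
  have hnJ : n * J ≠ ⊤ := ENNReal.mul_ne_top (by simp) hJtop
  have h6 : (n + 1) * J ≤ n * ((n + 1) * (ENNReal.ofReal a * P)) + n * J := by
    calc (n + 1) * J = (n + 1) * (n * volume (K : Set (Euc n))) := by rw [h3]
      _ ≤ (n + 1) * (n * (ENNReal.ofReal a * P + I)) := by gcongr; exact h5.trans (by gcongr)
      _ = n * ((n + 1) * (ENNReal.ofReal a * P)) + n * ((n + 1) * I) := by ring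
      _ = _ := by rw [h2]
  rw [add_mul, one_mul, add_comm, ENNReal.add_le_add_iff_right hnJ] at h6
  refine h6.trans (le_of_eq (by ring))

end body

/-! ### Cone volume and dual curvature -/

section body

variable (K : ConvexBody (Euc n))

theorem supportFn_le_radialFn (h0 : (0 : Euc n) ∈ interior (K : Set (Euc n))) {v u : Sph n}
    (hu : u ∈ normals K (radialFn K v • (v : Euc n))) : supportFn K u ≤ radialFn K v := by
  rw [supportFn_eq_of_mem_normals K (radialFn_smul_mem K h0 v) hu, real_inner_smul_left]
  have h1 : inner ℝ (v : Euc n) (u : Euc n) ≤ 1 := by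
    simpa using real_inner_le_norm (v : Euc n) (u : Euc n)
  exact mul_le_of_le_one_right (radialFn_pos K h0 v).le h1

theorem radialFn_le {R : ℝ} (h0 : (0 : Euc n) ∈ interior (K : Set (Euc n)))
    (hR : ∀ x ∈ K, ‖x‖ ≤ R) (v : Sph n) : radialFn K v ≤ R := by
  have := hR _ (radialFn_smul_mem K h0 v)
  rwa [norm_smul, Real.norm_eq_abs, abs_of_pos (radialFn_pos K h0 v), norm_eq_of_mem_sphere,
    mul_one] at this

theorem supportFn_le_of_norm_le {R : ℝ} (hR : ∀ x ∈ K, ‖x‖ ≤ R) (u : Sph n) :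
    supportFn K u ≤ R := by
  refine supportFn_le K fun x hx => ?_
  simpa using (real_inner_le_norm x (u : Euc n)).trans (by simpa using hR x hx)

theorem abs_inner_le_supportFn (hsymm : ∀ x ∈ K, -x ∈ K) {x : Euc n} (hx : x ∈ K) (u : Euc n) :
    |inner ℝ x u| ≤ supportFn K u := by
  refine abs_le'.2 ⟨inner_le_supportFn K hx u, ?_⟩
  rw [← inner_neg_left]
  exact inner_le_supportFn K (hsymm x hx) u

theorem measurable_supportFn_rpow (s : ℝ) :
    Measurable fun u : Sph n => ENNReal.ofReal (supportFn K u ^ s) :=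
  (((continuous_supportFn K).comp continuous_subtype_val).measurable.pow_const s).ennreal_ofReal

theorem measurable_radialFn_rpow (h0 : (0 : Euc n) ∈ interior (K : Set (Euc n))) (s : ℝ) :
    Measurable fun u : Sph n => ENNReal.ofReal (radialFn K u ^ s) :=
  ((continuous_radialFn K h0).measurable.pow_const s).ennreal_ofReal

theorem lintegral_radialFn_ne_top (h0 : (0 : Euc n) ∈ interior (K : Set (Euc n)))
    (hn : n ≠ 0) :
    ∫⁻ v : Sph n, ENNReal.ofReal (radialFn K v ^ (n : ℝ)) ∂(sphMeasure n) ≠ ⊤ := by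
  rw [← volume_eq_lintegral_radialFn K h0 hn]
  exact ENNReal.mul_ne_top (by simp) K.isCompact.measure_lt_top.ne

/-- If `K` is contained in the slab `|⟨x, w⟩| ≤ a` and its support function is at least `a`, then a
fixed proportion of the cone volume is carried by normals with `h_K < 2na`. -/
theorem lintegral_radialFn_pow_le_of_slab (h0 : (0 : Euc n) ∈ interior (K : Set (Euc n)))
    (hn : n ≠ 0) {w : Sph n} {a : ℝ} (ha0 : 0 < a) (ha : ∀ x ∈ K, |inner ℝ x (w : Euc n)| ≤ a)
    (hmin : ∀ u : Sph n, a ≤ supportFn K u) :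
    ∫⁻ v : Sph n, ENNReal.ofReal (radialFn K v ^ (n : ℝ)) ∂(sphMeasure n) ≤
      2 * n * ∫⁻ v in reverseRadialGauss K {u : Sph n | supportFn K u < 2 * n * a},
        ENNReal.ofReal (radialFn K v ^ (n : ℝ)) ∂(sphMeasure n) := by
  set ω : Set (Sph n) := {u : Sph n | supportFn K u < 2 * n * a} with hω
  have hωm : MeasurableSet ω :=
    (isOpen_lt ((continuous_supportFn K).comp continuous_subtype_val)
      continuous_const).measurableSet
  have hα := nullMeasurableSet_reverseRadialGauss K h0 hωm
  have hn' : (0 : ℝ) < n := by positivity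
  have h1 := lintegral_radialFn_pow_le K h0 hn (w := (w : Euc n)) (by simp) ha
  have hJtop := lintegral_radialFn_ne_top K h0 hn
  set J := ∫⁻ v : Sph n, ENNReal.ofReal (radialFn K v ^ (n : ℝ)) ∂(sphMeasure n) with hJ
  -- Since `|∂_w g| ≤ 1/h`, the factor `a |∂_w g|` is at most 1 everywhere and at most `1/(2n)`
  -- where `h ≥ 2na`.
  have h2 : ENNReal.ofReal a * ∫⁻ v : Sph n, ENNReal.ofReal (radialFn K v ^ (n : ℝ)
        * |lineDeriv ℝ (gauge (K : Set (Euc n))) v w|) ∂(sphMeasure n) ≤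
      ENNReal.ofReal (1 / (2 * n)) * J + ∫⁻ v in reverseRadialGauss K ω,
        ENNReal.ofReal (radialFn K v ^ (n : ℝ)) ∂(sphMeasure n) := by
    rw [← lintegral_indicator₀ hα, hJ, ← lintegral_const_mul' _ _ ENNReal.ofReal_ne_top,
      ← lintegral_const_mul' _ _ ENNReal.ofReal_ne_top,
      ← lintegral_add_left ((measurable_radialFn_rpow K h0 _).const_mul _)]
    refine lintegral_mono_ae ?_
    filter_upwards [ae_differentiableAt_gauge K h0] with v hv
    obtain ⟨u, hu⟩ := normals_nonempty K h0 v
    have hρ := radialFn_pos K h0 v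
    have hhu := supportFn_pos K h0 u
    have hder := supportFn_mul_lineDeriv_gauge K h0 v hv hu w
    have hin : |inner ℝ (w : Euc n) (u : Euc n)| ≤ 1 := by
      simpa using abs_real_inner_le_norm (w : Euc n) (u : Euc n)
    rw [← hder, abs_mul, abs_of_pos hhu] at hin
    set D := |lineDeriv ℝ (gauge (K : Set (Euc n))) v w| with hD
    have hD0 : 0 ≤ D := abs_nonneg _
    rw [← ENNReal.ofReal_mul ha0.le, ← ENNReal.ofReal_mul (by positivity)]
    by_cases hmem : v ∈ reverseRadialGauss K ω
    · rw [indicator_of_mem hmem]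
      refine le_trans (ENNReal.ofReal_le_ofReal ?_) le_add_self
      have : a * D ≤ 1 := (mul_le_mul_of_nonneg_right (hmin u) hD0).trans hin
      calc a * (radialFn K v ^ (n : ℝ) * D) = radialFn K v ^ (n : ℝ) * (a * D) := by ring
        _ ≤ radialFn K v ^ (n : ℝ) * 1 := by gcongr
        _ = _ := mul_one _
    · refine le_trans (ENNReal.ofReal_le_ofReal ?_) le_self_add
      have hu2 : 2 * n * a ≤ supportFn K u := by
        by_contra hlt
        exact hmem ⟨u, hu, not_le.1 hlt⟩
      have : 2 * n * a * D ≤ 1 := (mul_le_mul_of_nonneg_right hu2 hD0).trans hin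
      have h3 : a * D ≤ 1 / (2 * n) := by
        rw [le_div_iff₀ (by positivity)]; linarith
      calc a * (radialFn K v ^ (n : ℝ) * D) = (a * D) * radialFn K v ^ (n : ℝ) := by ring
        _ ≤ _ := by gcongr
  set L := ∫⁻ v in reverseRadialGauss K ω,
        ENNReal.ofReal (radialFn K v ^ (n : ℝ)) ∂(sphMeasure n) with hL
  have h3 : J ≤ n * (ENNReal.ofReal (1 / (2 * n)) * J + L) := h1.trans (by gcongr)
  have h4 : (2 * n : ENNReal) * ENNReal.ofReal (1 / (2 * n)) = 1 := by
    rw [show (2 * n : ENNReal) = ENNReal.ofReal (2 * n) by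
      rw [ENNReal.ofReal_mul (by norm_num)]; simp, ← ENNReal.ofReal_mul (by positivity),
      mul_one_div_cancel (by positivity), ENNReal.ofReal_one]
  -- The far normals account for at most half of `J`; doubling lets that part be cancelled.
  have h5 : J + J ≤ J + 2 * n * L := by
    calc J + J = 2 * J := (two_mul J).symm
      _ ≤ 2 * (n * (ENNReal.ofReal (1 / (2 * n)) * J + L)) := by gcongr
      _ = (2 * n * ENNReal.ofReal (1 / (2 * n))) * J + 2 * n * L := by ring
      _ = _ := by rw [h4, one_mul]
  exact (ENNReal.add_le_add_iff_left hJtop).1 h5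

theorem setLIntegral_radialFn_le_dualCurvature (h0 : (0 : Euc n) ∈ interior (K : Set (Euc n)))
    {R q : ℝ} (hq : q ≤ n) (hR : ∀ x ∈ K, ‖x‖ ≤ R) {ω : Set (Sph n)} (hω : MeasurableSet ω) :
    ∫⁻ v in reverseRadialGauss K ω, ENNReal.ofReal (radialFn K v ^ (n : ℝ)) ∂(sphMeasure n) ≤
      ENNReal.ofReal (R ^ (n - q)) * dualCurvature q K h0 ω := by
  rw [dualCurvature_apply q K h0 hω, ← lintegral_const_mul' _ _ ENNReal.ofReal_ne_top]
  refine lintegral_mono fun v => ?_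
  have hρ := radialFn_pos K h0 v
  have hρR := radialFn_le K h0 hR v
  rw [← ENNReal.ofReal_mul (Real.rpow_nonneg (hρ.le.trans hρR) _)]
  refine ENNReal.ofReal_le_ofReal ?_
  calc radialFn K v ^ (n : ℝ) = radialFn K v ^ (n - q) * radialFn K v ^ q := by
        rw [← Real.rpow_add hρ, sub_add_cancel]
    _ ≤ _ := by gcongr

theorem dualCurvature_le_setLIntegral_radialFn (h0 : (0 : Euc n) ∈ interior (K : Set (Euc n)))
    {t q : ℝ} (hq : q ≤ n) (ht : 0 ≤ t) {ω : Set (Sph n)} (hω : MeasurableSet ω)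
    (hωt : ∀ u ∈ ω, t ≤ supportFn K u) :
    ENNReal.ofReal (t ^ (n - q)) * dualCurvature q K h0 ω ≤
    ∫⁻ v in reverseRadialGauss K ω, ENNReal.ofReal (radialFn K v ^ (n : ℝ)) ∂(sphMeasure n) := by
  have hα := nullMeasurableSet_reverseRadialGauss K h0 hω
  rw [dualCurvature_apply q K h0 hω, ← lintegral_const_mul' _ _ ENNReal.ofReal_ne_top]
  refine lintegral_mono_ae ?_
  filter_upwards [ae_restrict_mem₀ hα] with v hv
  obtain ⟨u, hu, huω⟩ := hv
  have hρ := radialFn_pos K h0 v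
  have htρ : t ≤ radialFn K v := (hωt u huω).trans (supportFn_le_radialFn K h0 hu)
  rw [← ENNReal.ofReal_mul (by positivity)]
  refine ENNReal.ofReal_le_ofReal ?_
  calc t ^ (n - q) * radialFn K v ^ q ≤ radialFn K v ^ (n - q) * radialFn K v ^ q := by gcongr
    _ = _ := by rw [← Real.rpow_add hρ, sub_add_cancel]

/-- Undoing the density `h^(-p)` turns the hypothesis on the `L_p` measure into a comparison of dual
curvature with `∫ h^p`. -/
theorem setLIntegral_lpDualCurvature (p q : ℝ) (h0 : (0 : Euc n) ∈ interior (K : Set (Euc n)))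
    {ω : Set (Sph n)} (hω : MeasurableSet ω) :
    ∫⁻ u in ω, ENNReal.ofReal (supportFn K u ^ p) ∂(lpDualCurvature p q K h0) =
      dualCurvature q K h0 ω := by
  rw [lpDualCurvature, setLIntegral_withDensity_eq_setLIntegral_mul _
    (measurable_supportFn_rpow K (-p)) (measurable_supportFn_rpow K p) hω, ← setLIntegral_one]
  refine lintegral_congr fun u => ?_
  have hu := supportFn_pos K h0 u
  rw [Pi.mul_apply, ← ENNReal.ofReal_mul (by positivity), ← Real.rpow_add hu, neg_add_cancel,
    Real.rpow_zero, ENNReal.ofReal_one]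

theorem dualCurvature_le_of_lpDualCurvature_le {p q : ℝ}
    (h0 : (0 : Euc n) ∈ interior (K : Set (Euc n))) {c : ENNReal}
    (h : lpDualCurvature p q K h0 ≤ c • sphMeasure n) {ω : Set (Sph n)} (hω : MeasurableSet ω) :
    dualCurvature q K h0 ω ≤ c * ∫⁻ u in ω, ENNReal.ofReal (supportFn K u ^ p) ∂(sphMeasure n) := by
  rw [← setLIntegral_lpDualCurvature K p q h0 hω]
  refine (lintegral_mono' (Measure.restrict_mono le_rfl h) le_rfl).trans (le_of_eq ?_)
  rw [Measure.restrict_smul, lintegral_smul_measure, smul_eq_mul]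

theorem le_dualCurvature_of_le_lpDualCurvature {p q : ℝ}
    (h0 : (0 : Euc n) ∈ interior (K : Set (Euc n))) {c : ENNReal}
    (h : c • sphMeasure n ≤ lpDualCurvature p q K h0) {ω : Set (Sph n)} (hω : MeasurableSet ω) :
    c * ∫⁻ u in ω, ENNReal.ofReal (supportFn K u ^ p) ∂(sphMeasure n) ≤ dualCurvature q K h0 ω := by
  rw [← setLIntegral_lpDualCurvature K p q h0 hω]
  refine le_trans (le_of_eq ?_) (lintegral_mono' (Measure.restrict_mono le_rfl h) le_rfl)
  rw [Measure.restrict_smul, lintegral_smul_measure, smul_eq_mul]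

end body

/-! ### Singular integrals and caps on the sphere -/

theorem exists_linearIsometryEquiv_apply_eq {e f : Euc n} (h : ‖e‖ = ‖f‖) :
    ∃ T : Euc n ≃ₗᵢ[ℝ] Euc n, T e = f :=
  ⟨_, Submodule.reflection_sub h⟩

theorem setLIntegral_closedBall_abs_apply_rpow_lt_top {s : ℝ} (hs : -1 < s) (i : Fin n) :
    ∫⁻ x in closedBall (0 : Euc n) 1, ENNReal.ofReal (|x i| ^ s) < ⊤ := by
  -- The ball lies in the cube `[-1,1]^n`, where the integrand is a product of functions of one
  -- variable.
  set f : Fin n → ℝ → ℝ := fun j =>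
    (Icc (-1 : ℝ) 1).indicator fun t => if j = i then |t| ^ s else 1 with hf
  have hfi : ∀ j, Integrable (f j) := by
    intro j
    rw [hf]
    refine (integrable_indicator_iff measurableSet_Icc).2 ?_
    by_cases hj : j = i
    · simp only [hj, if_true]
      have hpos : IntervalIntegrable (fun t : ℝ => |t| ^ s) volume 0 1 := by
        refine (intervalIntegral.intervalIntegrable_rpow' hs).congr fun t ht => ?_
        rw [uIoc_of_le zero_le_one] at ht
        simp only [abs_of_pos ht.1]
      have hneg : IntervalIntegrable (fun t : ℝ => |t| ^ s) volume (-1) 0 := by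
        have := ((IntervalIntegrable.iff_comp_neg (by simp)).1 hpos).symm
        simpa using this
      exact (intervalIntegrable_iff_integrableOn_Icc_of_le (by norm_num)).1 (hneg.trans hpos)
    · simp only [hj, if_false]
      exact integrableOn_const (by simp)
  have hint : Integrable fun x : Fin n → ℝ => ∏ j, f j (x j) := Integrable.fintype_prod_dep hfi
  have hfin := hint.lintegral_lt_top
  rw [← (PiLp.volume_preserving_ofLp (Fin n)).lintegral_comp_emb
    (MeasurableEquiv.toLp 2 (Fin n → ℝ)).symm.measurableEmbedding] at hfin
  refine lt_of_le_of_lt ?_ hfin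
  rw [← lintegral_indicator measurableSet_closedBall]
  refine lintegral_mono fun x => ?_
  by_cases hx : x ∈ closedBall (0 : Euc n) 1
  · rw [indicator_of_mem hx]
    refine ENNReal.ofReal_le_ofReal (le_of_eq ?_)
    have hxj : ∀ j, x j ∈ Icc (-1 : ℝ) 1 := fun j => by
      have h1 := PiLp.norm_apply_le x j
      rw [mem_closedBall_zero_iff] at hx
      exact abs_le.1 (h1.trans hx)
    have : ∀ j, f j (x j) = if j = i then |x j| ^ s else 1 := fun j => by
      rw [hf]; exact indicator_of_mem (hxj j) _
    simp only [this, Finset.prod_ite_eq', Finset.mem_univ, if_true]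
  · rw [indicator_of_notMem hx]; exact zero_le

/-- The singular integrals `∫ |⟨e, u⟩|^s` over the sphere are bounded uniformly in `e` for
`s > -1`. -/
theorem exists_lintegral_abs_inner_rpow_le (hn : n ≠ 0) {s : ℝ} (hs : -1 < s) :
    ∃ M : ℝ, 0 < M ∧ ∀ e : Sph n,
      ∫⁻ u : Sph n, ENNReal.ofReal (|inner ℝ (e : Euc n) (u : Euc n)| ^ s) ∂(sphMeasure n) ≤
        ENNReal.ofReal M := by
  have hn1 : (1 : ℝ) ≤ n := by exact_mod_cast Nat.one_le_iff_ne_zero.2 hn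
  have hns : 0 < n + s := by linarith
  let i : Fin n := ⟨0, Nat.pos_of_ne_zero hn⟩
  set B := ∫⁻ x in closedBall (0 : Euc n) 1, ENNReal.ofReal (|x i| ^ s) with hB
  have hBtop : B < ⊤ := setLIntegral_closedBall_abs_apply_rpow_lt_top hs i
  refine ⟨(n + s) * B.toReal + 1, by positivity, fun e => ?_⟩
  have hball : ∫⁻ x in closedBall (0 : Euc n) 1, ENNReal.ofReal (|inner ℝ (e : Euc n) x| ^ s)
      = B := by
    -- An isometry carrying `e` to a coordinate vector shows that the integral over the ball is
    -- independent of `e`.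
    obtain ⟨T, hT⟩ := exists_linearIsometryEquiv_apply_eq (e := (e : Euc n))
      (f := EuclideanSpace.single i (1 : ℝ)) (by simp)
    have h1 := T.measurePreserving.setLIntegral_comp_preimage_emb
      T.toHomeomorph.measurableEmbedding (fun x : Euc n => ENNReal.ofReal (|x i| ^ s))
      (closedBall 0 1)
    have h2 : T ⁻¹' closedBall 0 1 = closedBall (0 : Euc n) 1 := by ext x; simp
    rw [h2] at h1
    rw [hB, ← h1]
    refine lintegral_congr fun x => ?_
    rw [← T.inner_map_map, hT, EuclideanSpace.inner_single_left]
    simp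
  have hpolar := setLIntegral_homogeneous hn (s := closedBall (0 : Euc n) 1)
    measurableSet_closedBall (ρ := fun _ => 1) (fun _ => zero_le_one)
    (fun v r hr => by
      rw [mem_closedBall_zero_iff, norm_smul, norm_eq_of_mem_sphere, Real.norm_eq_abs,
        abs_of_pos hr, mul_one])
    (G := fun x => ENNReal.ofReal (|inner ℝ (e : Euc n) x| ^ s)) (by fun_prop) hns
    (fun v r hr => by
      rw [real_inner_smul_right, abs_mul, abs_of_pos hr,
        Real.mul_rpow hr.le (abs_nonneg _), ENNReal.ofReal_mul (by positivity)])
  rw [hball, lintegral_const_mul' _ _ ENNReal.ofReal_ne_top, Real.one_rpow] at hpolar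
  have h3 : ∫⁻ u : Sph n, ENNReal.ofReal (|inner ℝ (e : Euc n) (u : Euc n)| ^ s) ∂(sphMeasure n)
      = ENNReal.ofReal (n + s) * B := by
    rw [hpolar, ← mul_assoc, ← ENNReal.ofReal_mul hns.le, mul_one_div_cancel hns.ne',
      ENNReal.ofReal_one, one_mul]
  rw [h3, ← ENNReal.ofReal_toReal hBtop.ne, ← ENNReal.ofReal_mul hns.le]
  refine ENNReal.ofReal_le_ofReal ?_
  rw [ENNReal.toReal_ofReal ENNReal.toReal_nonneg]
  linarith

/-- Needed because `0 ^ s = 0` for real powers with `s < 0`, so the pointwise bound of `h^p` by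
`|⟨e,u⟩|^s` may fail on the equator. -/
theorem ae_inner_ne_zero (e : Sph n) :
    ∀ᵐ u : Sph n ∂(sphMeasure n), inner ℝ (e : Euc n) (u : Euc n) ≠ 0 := by
  rw [ae_iff]
  simp only [ne_eq, not_not]
  have hms : MeasurableSet {u : Sph n | inner ℝ (e : Euc n) (u : Euc n) = 0} :=
    (isClosed_eq (by fun_prop) continuous_const).measurableSet
  rw [Measure.toSphere_apply' _ hms]
  set W : Submodule ℝ (Euc n) := (innerSL ℝ (e : Euc n)).ker with hW
  have hWt : W ≠ ⊤ := by
    intro h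
    have : (e : Euc n) ∈ W := h ▸ Submodule.mem_top
    rw [hW, LinearMap.mem_ker] at this
    simp at this
  refine mul_eq_zero.2 (Or.inr (measure_mono_null ?_ (Measure.addHaar_submodule volume W hWt)))
  rintro _ ⟨t, ht, _, ⟨v, hv, rfl⟩, rfl⟩
  refine W.smul_mem t ?_
  rw [hW, LinearMap.mem_ker]
  exact hv

/-- The caps `⟨e, u⟩ ≥ 1/2` have measure bounded from below. -/
theorem exists_le_sphMeasure_cap (n : ℕ) :
    ∃ b : ℝ, 0 < b ∧ ∀ e : Sph n,
      ENNReal.ofReal b ≤ sphMeasure n {u | 1 / 2 ≤ inner ℝ (e : Euc n) (u : Euc n)} := by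
  set b : ENNReal := Measure.toSphereBallBound n 1 * volume (ball (0 : Euc n) 1) with hb
  have hb0 : b ≠ 0 := mul_ne_zero (by simpa using (Measure.toSphereBallBound_pos n 1).ne')
    (measure_ball_pos _ _ one_pos).ne'
  have hbt : b ≠ ⊤ := ENNReal.mul_ne_top (by simp) measure_ball_lt_top.ne
  refine ⟨b.toReal, ENNReal.toReal_pos hb0 hbt, fun e => ?_⟩
  rw [ENNReal.ofReal_toReal hbt]
  have h := (volume : Measure (Euc n)).toSphereBallBound_mul_measure_unitBall_le_toSphere_ball
    one_pos e
  rw [finrank_euc] at h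
  -- The cap contains the spherical ball of chordal radius 1 about `e`, since `‖u - e‖² = 2 -
  -- 2⟨e,u⟩`.
  refine h.trans (measure_mono fun u hu => ?_)
  have h1 : ‖(u : Euc n) - e‖ < 1 := by
    rw [← dist_eq_norm]; exact hu
  have h2 := norm_sub_sq_real (u : Euc n) e
  rw [norm_eq_of_mem_sphere, norm_eq_of_mem_sphere, real_inner_comm] at h2
  have h3 : ‖(u : Euc n) - e‖ ^ 2 < 1 := by
    rw [sq_lt_one_iff₀ (norm_nonneg _)]; exact h1
  show (1 : ℝ) / 2 ≤ inner ℝ (e : Euc n) (u : Euc n)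
  linarith

/-- In `h^p = h^(p-s) h^s` the first factor is monotone and takes the upper bound on `h`, the second
is antitone and takes the lower one. -/
theorem rpow_le_of_mul_le {h t R c p s : ℝ} (hR : 0 < R) (hc : 0 < c) (hl : R * c ≤ h) (ht : h ≤ t)
    (hs : s ≤ 0) (hsp : s ≤ p) : h ^ p ≤ t ^ (p - s) * R ^ s * c ^ s := by
  have hh : 0 < h := (mul_pos hR hc).trans_le hl
  calc h ^ p = h ^ (p - s) * h ^ s := by rw [← Real.rpow_add hh, sub_add_cancel]
    _ ≤ t ^ (p - s) * (R * c) ^ s :=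
      mul_le_mul (Real.rpow_le_rpow hh.le ht (sub_nonneg.2 hsp))
        (Real.rpow_le_rpow_of_nonpos (mul_pos hR hc) hl hs) (by positivity)
        (Real.rpow_nonneg (hh.le.trans ht) _)
    _ = _ := by rw [Real.mul_rpow hR.le hc.le, mul_assoc]

theorem min_mul_rpow_le {h R p : ℝ} (hR : 0 < R) (hl : R / 2 ≤ h) (hu : h ≤ R) :
    min 1 (2 ^ (-p)) * R ^ p ≤ h ^ p := by
  have hh : 0 < h := (half_pos hR).trans_le hl
  rcases le_total p 0 with hp | hp
  · calc _ ≤ 1 * R ^ p := by gcongr; exact min_le_left _ _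
      _ ≤ h ^ p := by rw [one_mul]; exact Real.rpow_le_rpow_of_nonpos hh hu hp
  · calc _ ≤ 2 ^ (-p) * R ^ p := by gcongr; exact min_le_right _ _
      _ = (R / 2) ^ p := by
        rw [Real.div_rpow hR.le zero_le_two, Real.rpow_neg zero_le_two]; ring
      _ ≤ h ^ p := Real.rpow_le_rpow (half_pos hR).le hl hp

/-! ### Volume estimates from the curvature bounds -/

section body

variable (K : ConvexBody (Euc n))

/-- Serves twice: on the whole sphere with `t = R`, and on the normals with `h < 2na`, where the
positive power of `t` records the thinness of the body. -/
theorem setLIntegral_radialFn_le_of_supportFn_le {p q s t R lam M : ℝ}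
    (h0 : (0 : Euc n) ∈ interior (K : Set (Euc n))) (hq : q ≤ n) (hs : s ≤ 0) (hsp : s ≤ p)
    (hR0 : 0 < R) (hR : ∀ x ∈ K, ‖x‖ ≤ R) (ht : 0 ≤ t) (hlam : 0 ≤ lam) {e : Sph n}
    (he : ∀ u : Sph n, R * |inner ℝ (e : Euc n) (u : Euc n)| ≤ supportFn K u)
    (hM : ∫⁻ u : Sph n, ENNReal.ofReal (|inner ℝ (e : Euc n) (u : Euc n)| ^ s) ∂(sphMeasure n) ≤
      ENNReal.ofReal M)
    (hle : lpDualCurvature p q K h0 ≤ ENNReal.ofReal lam • sphMeasure n)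
    {ω : Set (Sph n)} (hω : MeasurableSet ω) (hωt : ∀ u ∈ ω, supportFn K u ≤ t) :
    ∫⁻ v in reverseRadialGauss K ω, ENNReal.ofReal (radialFn K v ^ (n : ℝ)) ∂(sphMeasure n) ≤
      ENNReal.ofReal (R ^ (n - q) * (lam * (t ^ (p - s) * R ^ s * M))) := by
  have h1 : ∫⁻ u in ω, ENNReal.ofReal (supportFn K u ^ p) ∂(sphMeasure n) ≤
      ENNReal.ofReal (t ^ (p - s) * R ^ s * M) := by
    have htR : 0 ≤ t ^ (p - s) * R ^ s := by positivity
    calc ∫⁻ u in ω, ENNReal.ofReal (supportFn K u ^ p) ∂(sphMeasure n)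
        ≤ ∫⁻ u in ω, ENNReal.ofReal (t ^ (p - s) * R ^ s) *
            ENNReal.ofReal (|inner ℝ (e : Euc n) (u : Euc n)| ^ s) ∂(sphMeasure n) := by
          refine lintegral_mono_ae ?_
          filter_upwards [ae_restrict_mem hω, ae_restrict_of_ae (ae_inner_ne_zero e)] with u hu hne
          rw [← ENNReal.ofReal_mul htR]
          exact ENNReal.ofReal_le_ofReal
            (rpow_le_of_mul_le hR0 (abs_pos.2 hne) (he u) (hωt u hu) hs hsp)
      _ ≤ ∫⁻ u : Sph n, ENNReal.ofReal (t ^ (p - s) * R ^ s) *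
            ENNReal.ofReal (|inner ℝ (e : Euc n) (u : Euc n)| ^ s) ∂(sphMeasure n) :=
          setLIntegral_le_lintegral _ _
      _ ≤ _ := by
          rw [lintegral_const_mul' _ _ ENNReal.ofReal_ne_top, ENNReal.ofReal_mul htR]
          gcongr
  calc _ ≤ ENNReal.ofReal (R ^ (n - q)) * dualCurvature q K h0 ω :=
        setLIntegral_radialFn_le_dualCurvature K h0 hq hR hω
    _ ≤ ENNReal.ofReal (R ^ (n - q)) *
        (ENNReal.ofReal lam * ENNReal.ofReal (t ^ (p - s) * R ^ s * M)) := by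
      gcongr
      exact (dualCurvature_le_of_lpDualCurvature_le K h0 hle hω).trans (by gcongr)
    _ = _ := by rw [← ENNReal.ofReal_mul hlam, ← ENNReal.ofReal_mul (by positivity)]

theorem reverseRadialGauss_univ (h0 : (0 : Euc n) ∈ interior (K : Set (Euc n))) :
    reverseRadialGauss K univ = univ :=
  eq_univ_of_forall fun v => by
    obtain ⟨u, hu⟩ := normals_nonempty K h0 v
    exact ⟨u, hu, mem_univ u⟩

/-- On the cap `R/2 ≤ h ≤ R`, so `h^p` is comparable with `R^p` for either sign of `p`, and `ρ ≥ h ≥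
R/2` on its reverse image. -/
theorem le_lintegral_radialFn_of_cap {p q R lam b : ℝ}
    (h0 : (0 : Euc n) ∈ interior (K : Set (Euc n))) (hq : q ≤ n)
    (hR0 : 0 < R) (hR : ∀ x ∈ K, ‖x‖ ≤ R) (hlam : 0 < lam) {e : Sph n}
    (he : ∀ u : Sph n, R * |inner ℝ (e : Euc n) (u : Euc n)| ≤ supportFn K u)
    (hb : ENNReal.ofReal b ≤ sphMeasure n {u | 1 / 2 ≤ inner ℝ (e : Euc n) (u : Euc n)})
    (hle : ENNReal.ofReal lam⁻¹ • sphMeasure n ≤ lpDualCurvature p q K h0) :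
    ENNReal.ofReal ((R / 2) ^ (n - q) * (lam⁻¹ * (min 1 (2 ^ (-p)) * R ^ p * b))) ≤
      ∫⁻ v : Sph n, ENNReal.ofReal (radialFn K v ^ (n : ℝ)) ∂(sphMeasure n) := by
  set ω : Set (Sph n) := {u | 1 / 2 ≤ inner ℝ (e : Euc n) (u : Euc n)} with hω
  have hωm : MeasurableSet ω := (isClosed_le continuous_const (by fun_prop)).measurableSet
  have hωR : ∀ u ∈ ω, R / 2 ≤ supportFn K u := fun u hu => by
    refine le_trans ?_ (he u)
    have : (1 : ℝ) / 2 ≤ |inner ℝ (e : Euc n) (u : Euc n)| := le_trans hu (le_abs_self _)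
    calc R / 2 = R * (1 / 2) := by ring
      _ ≤ _ := by gcongr
  have hm : 0 ≤ min 1 ((2 : ℝ) ^ (-p)) * R ^ p := by positivity
  have h1 : ENNReal.ofReal (min 1 (2 ^ (-p)) * R ^ p * b) ≤
      ∫⁻ u in ω, ENNReal.ofReal (supportFn K u ^ p) ∂(sphMeasure n) := by
    calc _ ≤ ENNReal.ofReal (min 1 (2 ^ (-p)) * R ^ p) * sphMeasure n ω := by
          rw [ENNReal.ofReal_mul hm]; gcongr
      _ = ∫⁻ _ in ω, ENNReal.ofReal (min 1 (2 ^ (-p)) * R ^ p) ∂(sphMeasure n) := by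
          rw [setLIntegral_const]
      _ ≤ _ := setLIntegral_mono' hωm fun u hu => ENNReal.ofReal_le_ofReal
          (min_mul_rpow_le hR0 (hωR u hu) (supportFn_le_of_norm_le K hR u))
  calc _ = ENNReal.ofReal ((R / 2) ^ (n - q)) *
        (ENNReal.ofReal lam⁻¹ * ENNReal.ofReal (min 1 (2 ^ (-p)) * R ^ p * b)) := by
        rw [← ENNReal.ofReal_mul (by positivity), ← ENNReal.ofReal_mul (by positivity)]
    _ ≤ ENNReal.ofReal ((R / 2) ^ (n - q)) * dualCurvature q K h0 ω := by
        gcongr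
        exact le_trans (by gcongr) (le_dualCurvature_of_le_lpDualCurvature K h0 hle hωm)
    _ ≤ _ := dualCurvature_le_setLIntegral_radialFn K h0 hq (by positivity) hωm hωR
    _ ≤ _ := setLIntegral_le_lintegral _ _

theorem exists_farthest_point (h0 : (0 : Euc n) ∈ interior (K : Set (Euc n))) (hn : n ≠ 0)
    (hsymm : ∀ x ∈ K, -x ∈ K) :
    ∃ (R : ℝ) (e : Sph n), 0 < R ∧ (∀ x ∈ K, ‖x‖ ≤ R) ∧
      ∀ u : Sph n, R * |inner ℝ (e : Euc n) (u : Euc n)| ≤ supportFn K u := by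
  obtain ⟨x, hx, hmax⟩ := K.isCompact.exists_isMaxOn K.nonempty continuous_norm.continuousOn
  have hR : ∀ y ∈ K, ‖y‖ ≤ ‖x‖ := fun y hy => hmax hy
  let v : Sph n := ⟨EuclideanSpace.single ⟨0, Nat.pos_of_ne_zero hn⟩ (1 : ℝ), by simp⟩
  have hx0 : 0 < ‖x‖ := (radialFn_pos K h0 v).trans_le (radialFn_le K h0 hR v)
  refine ⟨‖x‖, ⟨‖x‖⁻¹ • x, by simp [norm_smul, hx0.ne']⟩, hx0, hR, fun u => ?_⟩
  have := abs_inner_le_supportFn K hsymm hx u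
  simp only [real_inner_smul_left, abs_mul, abs_inv, abs_norm]
  rwa [mul_inv_cancel_left₀ hx0.ne']

theorem exists_minimal_slab (h0 : (0 : Euc n) ∈ interior (K : Set (Euc n))) [Nonempty (Sph n)]
    (hsymm : ∀ x ∈ K, -x ∈ K) :
    ∃ (a : ℝ) (w : Sph n), 0 < a ∧ (∀ x ∈ K, |inner ℝ x (w : Euc n)| ≤ a) ∧
      ∀ u : Sph n, a ≤ supportFn K u := by
  obtain ⟨w, -, hw⟩ := isCompact_univ.exists_isMinOn (univ_nonempty (α := Sph n))
    ((continuous_supportFn K).comp continuous_subtype_val).continuousOn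
  exact ⟨supportFn K w, w, supportFn_pos K h0 w, fun x hx => abs_inner_le_supportFn K hsymm hx w,
    fun u => hw (mem_univ u)⟩

theorem le_lintegral_radialFn (h0 : (0 : Euc n) ∈ interior (K : Set (Euc n))) {a : ℝ}
    (ha : 0 ≤ a) (hmin : ∀ u : Sph n, a ≤ supportFn K u) :
    ENNReal.ofReal (a ^ (n : ℝ) * (sphMeasure n).real univ) ≤
      ∫⁻ v : Sph n, ENNReal.ofReal (radialFn K v ^ (n : ℝ)) ∂(sphMeasure n) := by
  rw [ENNReal.ofReal_mul (by positivity), ofReal_measureReal, ← lintegral_const]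
  refine lintegral_mono fun v => ENNReal.ofReal_le_ofReal ?_
  obtain ⟨u, hu⟩ := normals_nonempty K h0 v
  have := (hmin u).trans (supportFn_le_radialFn K h0 hu)
  gcongr

theorem lintegral_radialFn_le (h0 : (0 : Euc n) ∈ interior (K : Set (Euc n))) {R : ℝ}
    (hR0 : 0 ≤ R) (hR : ∀ x ∈ K, ‖x‖ ≤ R) :
    ∫⁻ v : Sph n, ENNReal.ofReal (radialFn K v ^ (n : ℝ)) ∂(sphMeasure n) ≤
      ENNReal.ofReal (R ^ (n : ℝ) * (sphMeasure n).real univ) := by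
  rw [ENNReal.ofReal_mul (by positivity), ofReal_measureReal, ← lintegral_const]
  refine lintegral_mono fun v => ENNReal.ofReal_le_ofReal ?_
  have := radialFn_le K h0 hR v
  have := (radialFn_pos K h0 v).le
  gcongr

end body

/-- The elementary comparison of scales: `R` plays the role of the circumradius, `a` of the
inradius and `j` of the volume. -/
theorem exists_scale_bounds {N p q s S c₁ c₂ c₃ : ℝ} (hN : 0 < N) (hpq : p < q) (hsp : s < p)
    (hS : 0 < S) (h₁ : 0 < c₁) (h₂ : 0 < c₂) (h₃ : 0 < c₃) (hqN : q < N + p) :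
    ∃ C c : ℝ, 0 < c ∧ ∀ R a j : ℝ, 0 < R → 0 < a → c₁ * R ^ (N + p - q) ≤ j →
      j ≤ R ^ N * S → a ^ N * S ≤ j → j ≤ c₂ * R ^ (N + p - q) →
      j ≤ c₃ * (R ^ (N - q + s) * a ^ (p - s)) → R ≤ C ∧ c ≤ j := by
  -- Bound for `R / a`, from comparing the lower bound for `j` with the slab estimate.
  set k : ℝ := (c₃ / c₁) ^ (p - s)⁻¹ with hk
  have hk0 : 0 < k := by positivity
  refine ⟨(c₂ * k ^ N / S) ^ (q - p)⁻¹, c₁ * ((c₁ / S) ^ (q - p)⁻¹) ^ (N + p - q),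
    by positivity, fun R a j hR ha hB hB' hC hC' hD => ⟨?_, ?_⟩⟩
  · have hRN : R ^ N = R ^ (N + p - q) * R ^ (q - p) := by
      rw [← Real.rpow_add hR]; congr 1; ring
    have hRs : R ^ (N + p - q) = R ^ (N - q + s) * R ^ (p - s) := by
      rw [← Real.rpow_add hR]; congr 1; ring
    have h1 : R / a ≤ k := by
      rw [hk, Real.le_rpow_inv_iff_of_pos (by positivity) (by positivity) (sub_pos.2 hsp),
        Real.div_rpow hR.le ha.le, div_le_div_iff₀ (by positivity) h₁]
      have h2 := hB.trans hD
      rw [hRs] at h2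
      have h3 : R ^ (N - q + s) * (R ^ (p - s) * c₁) ≤ R ^ (N - q + s) * (c₃ * a ^ (p - s)) := by
        linarith
      exact le_of_mul_le_mul_left h3 (by positivity)
    have h2 : R ^ N ≤ k ^ N * a ^ N := by
      rw [← Real.mul_rpow hk0.le ha.le]
      exact Real.rpow_le_rpow hR.le ((div_le_iff₀ ha).1 h1) hN.le
    rw [Real.le_rpow_inv_iff_of_pos hR.le (by positivity) (sub_pos.2 hpq), le_div_iff₀ hS]
    have h3 : R ^ (N + p - q) * (R ^ (q - p) * S) ≤ R ^ (N + p - q) * (c₂ * k ^ N) := by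
      calc R ^ (N + p - q) * (R ^ (q - p) * S) = R ^ N * S := by rw [hRN]; ring
        _ ≤ k ^ N * a ^ N * S := by gcongr
        _ = k ^ N * (a ^ N * S) := by ring
        _ ≤ k ^ N * (c₂ * R ^ (N + p - q)) := mul_le_mul_of_nonneg_left (hC.trans hC') (by positivity)
        _ = _ := by ring
    exact le_of_mul_le_mul_left h3 (by positivity)
  · refine le_trans ?_ hB
    have hRN : R ^ N = R ^ (N + p - q) * R ^ (q - p) := by
      rw [← Real.rpow_add hR]; congr 1; ring
    -- The cap bound and `j ≤ R ^ N * S` give `c₁ ≤ R ^ (q - p) * S`.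
    have h1 : (c₁ / S) ^ (q - p)⁻¹ ≤ R := by
      rw [Real.rpow_inv_le_iff_of_pos (by positivity) hR.le (sub_pos.2 hpq), div_le_iff₀ hS]
      have h2 := hB.trans hB'
      rw [hRN] at h2
      have h3 : R ^ (N + p - q) * c₁ ≤ R ^ (N + p - q) * (R ^ (q - p) * S) := by linarith
      exact le_of_mul_le_mul_left h3 (by positivity)
    -- Here `q < N + p` enters: the lower bound on `R` passes to `R ^ (N + p - q)`.
    have : 0 ≤ N + p - q := by linarith
    gcongr

end DualMinkowski

end

/-! ### Assembly of the estimates -/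

theorem mainTheorem4 (n : ℕ) (lam p q : ℝ) (hlam : 1 < lam) (hp : -1 < p) (hpq : p < q)
    (hq : 0 < q) (hqn : q < min (n : ℝ) (n + p)) :
    ∃ C : ℝ, 1 < C ∧
      ∀ (K : ConvexBody (DualMinkowski.Euc n))
        (hint : (interior (K : Set (DualMinkowski.Euc n))).Nonempty)
        (hsymm : ∀ x ∈ K, -x ∈ K),
        ENNReal.ofReal lam⁻¹ • DualMinkowski.sphMeasure n ≤
            DualMinkowski.lpDualCurvature p q K
              (DualMinkowski.zero_mem_interior_of_symmetric K hint hsymm) →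
        DualMinkowski.lpDualCurvature p q K
              (DualMinkowski.zero_mem_interior_of_symmetric K hint hsymm) ≤
            ENNReal.ofReal lam • DualMinkowski.sphMeasure n →
        Metric.diam (K : Set (DualMinkowski.Euc n)) ≤ C ∧
          1 / C ≤ MeasureTheory.volume.real (K : Set (DualMinkowski.Euc n)) := by
  obtain ⟨hqn1, hqn2⟩ := lt_min_iff.1 hqn
  have hn0 : (0 : ℝ) < n := hq.trans hqn1
  have hn : n ≠ 0 := by
    rintro rfl
    simp at hn0
  have hlam0 : 0 < lam := one_pos.trans hlam
  -- `s > -1` makes the singular integral finite, and `s < p` leaves a positive power of `a`; both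
  -- fit because `p > -1`.
  obtain ⟨s, hs1, hs0, hsp⟩ : ∃ s : ℝ, -1 < s ∧ s < 0 ∧ s < p := by
    obtain ⟨s, hs1, hs2⟩ := exists_between (lt_min (by norm_num : (-1 : ℝ) < 0) hp)
    exact ⟨s, hs1, lt_min_iff.1 hs2⟩
  obtain ⟨M, hM0, hM⟩ := DualMinkowski.exists_lintegral_abs_inner_rpow_le hn hs1
  obtain ⟨b, hb0, hb⟩ := DualMinkowski.exists_le_sphMeasure_cap n
  set S : ℝ := (DualMinkowski.sphMeasure n).real Set.univ with hS
  have hS0 : 0 < S := by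
    let v : DualMinkowski.Sph n :=
      ⟨EuclideanSpace.single ⟨0, Nat.pos_of_ne_zero hn⟩ (1 : ℝ), by simp⟩
    refine ENNReal.toReal_pos ?_ (MeasureTheory.measure_ne_top _ _)
    exact ((ENNReal.ofReal_pos.2 hb0).trans_le
      ((hb v).trans (MeasureTheory.measure_mono (Set.subset_univ _)))).ne'
  -- The constants come from the cap (with `(R/2)^(n-q)`), the whole sphere with `t = R`, and the
  -- slab with `t = 2na`.
  obtain ⟨D, c, hc, hDc⟩ := DualMinkowski.exists_scale_bounds (N := n) (p := p) (q := q) (s := s)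
    (S := S) (c₁ := lam⁻¹ * min 1 (2 ^ (-p)) * b / 2 ^ (n - q)) (c₂ := lam * M)
    (c₃ := 2 * n * (lam * M * (2 * n) ^ (p - s))) hn0 hpq hsp hS0 (by positivity) (by positivity)
    (by positivity) hqn2
  have hmax : 0 ≤ max (2 * D) (n / c) := le_max_of_le_right (by positivity)
  -- `2D` bounds the diameter through `2R`, `n/c` handles `n|K| ≥ c`, and the summand 2 ensures `C >
  -- 1`.
  refine ⟨max (2 * D) (n / c) + 2, by linarith, fun K hint hsymm hlow hup => ?_⟩
  have h0 := DualMinkowski.zero_mem_interior_of_symmetric K hint hsymm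
  obtain ⟨R, e, hR0, hR, he⟩ := DualMinkowski.exists_farthest_point K h0 hn hsymm
  have : Nonempty (DualMinkowski.Sph n) := ⟨e⟩
  obtain ⟨a, w, ha0, ha, hmin⟩ := DualMinkowski.exists_minimal_slab K h0 hsymm
  set j : ℝ := n * MeasureTheory.volume.real (K : Set (DualMinkowski.Euc n)) with hj
  have hj0 : 0 ≤ j := by positivity
  have hJ := DualMinkowski.volume_eq_lintegral_radialFn K h0 hn
  have hjJ : ENNReal.ofReal j = n * MeasureTheory.volume (K : Set (DualMinkowski.Euc n)) := by
    rw [hj, ENNReal.ofReal_mul hn0.le, MeasureTheory.ofReal_measureReal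
      K.isCompact.measure_lt_top.ne, ENNReal.ofReal_natCast]
  rw [← hjJ] at hJ
  have hB := DualMinkowski.le_lintegral_radialFn_of_cap K h0 hqn1.le hR0 hR hlam0 he (hb e) hlow
  have hB' := DualMinkowski.lintegral_radialFn_le K h0 hR0.le hR
  have hC := DualMinkowski.le_lintegral_radialFn K h0 ha0.le hmin
  have hC' := DualMinkowski.setLIntegral_radialFn_le_of_supportFn_le K h0 hqn1.le hs0.le hsp.le
    hR0 hR hR0.le hlam0.le he (hM e) hup MeasurableSet.univ
    (fun u _ => DualMinkowski.supportFn_le_of_norm_le K hR u)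
  rw [DualMinkowski.reverseRadialGauss_univ K h0, MeasureTheory.Measure.restrict_univ] at hC'
  have hD := (DualMinkowski.lintegral_radialFn_pow_le_of_slab K h0 hn ha0 ha hmin).trans
    (mul_le_mul_right (DualMinkowski.setLIntegral_radialFn_le_of_supportFn_le K h0 hqn1.le hs0.le
      hsp.le hR0 hR (t := 2 * n * a) (by positivity) hlam0.le he (hM e) hup
      (isOpen_lt ((DualMinkowski.continuous_supportFn K).comp continuous_subtype_val)
        continuous_const).measurableSet (fun u hu => le_of_lt hu)) (2 * n : ENNReal))
  rw [show (2 * n : ENNReal) = ENNReal.ofReal (2 * n) by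
    rw [ENNReal.ofReal_mul zero_le_two]; simp, ← ENNReal.ofReal_mul (by positivity)] at hD
  rw [← hJ] at hB hB' hC hC' hD
  rw [ENNReal.ofReal_le_ofReal_iff (by positivity)] at hB' hC' hD
  rw [ENNReal.ofReal_le_ofReal_iff hj0] at hB hC
  have hB1 : lam⁻¹ * min 1 (2 ^ (-p)) * b / 2 ^ (n - q) * R ^ (n + p - q) ≤ j := by
    refine le_trans (le_of_eq ?_) hB
    rw [Real.div_rpow hR0.le zero_le_two,
      show (n + p - q : ℝ) = (n - q) + p by ring, Real.rpow_add hR0]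
    ring
  have hC1 : j ≤ lam * M * R ^ (n + p - q) := by
    refine hC'.trans (le_of_eq ?_)
    rw [show (n + p - q : ℝ) = (n - q) + (p - s) + s by ring, Real.rpow_add hR0,
      Real.rpow_add hR0]
    ring
  have hD1 : j ≤ 2 * n * (lam * M * (2 * n) ^ (p - s)) * (R ^ (n - q + s) * a ^ (p - s)) := by
    refine hD.trans (le_of_eq ?_)
    rw [Real.mul_rpow (by positivity) ha0.le, Real.rpow_add hR0]
    ring
  obtain ⟨hRD, hcj⟩ := hDc R a j hR0 ha0 hB1 hB' hC hC1 hD1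
  constructor
  · have hdiam : Metric.diam (K : Set (DualMinkowski.Euc n)) ≤ 2 * R := by
      refine Metric.diam_le_of_forall_dist_le (by positivity) fun x hx y hy => ?_
      rw [dist_eq_norm, two_mul]
      exact (norm_sub_le x y).trans (add_le_add (hR x hx) (hR y hy))
    have := le_max_left (2 * D) (n / c)
    linarith
  · have h1 : n / c ≤ max (2 * D) (n / c) + 2 := by
      have := le_max_right (2 * D) (n / c)
      linarith
    have hnc : 0 < n / c := by positivity
    calc 1 / (max (2 * D) (n / c) + 2) ≤ 1 / (n / c) := one_div_le_one_div_of_le hnc h1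
      _ = c / n := one_div_div _ _
      _ ≤ _ := by rw [div_le_iff₀ hn0, mul_comm]; exact hcj
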